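/- A $d$-dimensional lattice $L\subset\mathbb R^n$ is the set of integer combinations of $d$ linearly independent vectors (the columns of a matrix $B$), $\det(L)=\sqrt{\det(B^{T}B)}$, and $L^*=\{y\in\mathrm{span}(L):\langle y,x\rangle\in\mathbb Z\ \ \forall x\in L\}$ is its dual. A lattice subspace of $L^*$ is a linear subspace having a basis of vectors in $L^*$. The covering radius is $\mu(L)=\inf\{r\ge 0:\mathrm{span}(L)\subseteq L+rB_2^n\}$, where $B_2^n$ is the closed Euclidean unit ball. Put $$\eta_{\det}(L)=\max_{W}\det(L^*\cap W)^{-1/\dim W},\qquad \eta^{\circ}_\mu(L)=\sup_{R\in\mathbb R^{n\times n}\text{ non-singular}}\frac{\mu(RL)}{\sqrt{\mathrm{tr}(R^{T}R)}},$$ where $W$ ranges over the lattice subspaces of $L^*$ of positive dimension. Let $C^{\det}_{(\mu,\circ)}(n)$ be the smallest number such that $\eta^\circ_\mu(L)\le C^{\det}_{(\mu,\circ)}(n)\,\eta_{\det}(L)$ for every $n$-dimensional lattice $L\subset\mathbb R^n$, and let $C_{KL}(n)$ be the smallest number such that $$\mu(L)\le C_{KL}(n)\max_{W}\sqrt{\dim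 W}\,\det(L^*\cap W)^{-1/\dim W}$$ for every lattice $L\subset\mathbb R^n$ (for the zero lattice, the maximum over the empty set is read as $0$). **Theorem.** For every $n\ge 1$ these smallest numbers exist, are positive and finite, and $$C^{\det}_{(\mu,\circ)}(n)\le C_{KL}(n)\le K\,(1+\log n)\,C^{\det}_{(\mu,\circ)}(n)$$ for a universal constant $K>0$. Consequently the $\ell_2$ Kannan–Lovász conjecture, i.e. $C_{KL}(n)\le\mathrm{poly}\log n$ (there are $A,k$ with $C_{KL}(n)\le A(\log n)^k$ for all $n\ge2$), holds if and only if $C^{\det}_{(\mu,\circ)}(n)\le\mathrm{poly}\log n$. -/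

import Mathlib

open scoped ENNReal NNReal

noncomputable section

namespace EuclLattice

/-- The space `ℝⁿ` with its Euclidean norm and inner product. -/
abbrev E (n : ℕ) : Type := EuclideanSpace ℝ (Fin n)

/-- `b = (b₁, …, b_d)` is a basis of the lattice `L ⊂ ℝⁿ`: the vectors `bᵢ` are linearly
independent over `ℝ`, and `L` is the set of their integer linear combinations. -/
def IsBasisOf {n d : ℕ} (b : Fin d → E n) (L : Submodule ℤ (E n)) : Prop :=
  LinearIndependent ℝ b ∧ Submodule.span ℤ (Set.range b) = L

/-- `L` is a `d`-dimensional lattice in `ℝⁿ`. -/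
def IsLatticeOfDim {n : ℕ} (d : ℕ) (L : Submodule ℤ (E n)) : Prop :=
  ∃ b : Fin d → E n, IsBasisOf b L

/-- `L` is a lattice in `ℝⁿ`, of any dimension `d`. -/
def IsLattice {n : ℕ} (L : Submodule ℤ (E n)) : Prop :=
  ∃ d : ℕ, IsLatticeOfDim d L

/-- `√(det (BᵀB))` for the matrix `B` with columns `b₁, …, b_d`. -/
def gramVol {n d : ℕ} (b : Fin d → E n) : ℝ :=
  Real.sqrt (Matrix.gram ℝ b).det

/-- `√(det (BᵀB))` is the same for all bases of a lattice. -/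
theorem gramVol_eq_of_isBasisOf {n d e : ℕ} {L : Submodule ℤ (E n)} {b : Fin d → E n}
    {c : Fin e → E n} (hb : IsBasisOf b L) (hc : IsBasisOf c L) : gramVol b = gramVol c := by
  obtain ⟨hbi, hbL⟩ := hb
  obtain ⟨hci, hcL⟩ := hc
  have hbZ : LinearIndependent ℤ b := hbi.restrict_scalars (fun x y h => by simpa using h)
  have hcZ : LinearIndependent ℤ c := hci.restrict_scalars (fun x y h => by simpa using h)
  subst hbL
  let B : Module.Basis (Fin d) ℤ (Submodule.span ℤ (Set.range b)) := Module.Basis.span hbZ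
  let C : Module.Basis (Fin e) ℤ (Submodule.span ℤ (Set.range b)) :=
    (Module.Basis.span hcZ).map (LinearEquiv.ofEq _ _ hcL)
  have hB : ∀ i, (B i : E n) = b i := fun i => by simp [B, Module.Basis.span_apply]
  have hC : ∀ i, (C i : E n) = c i := fun i => by simp [C, Module.Basis.span_apply]
  have hde : d = e := by
    have h1 := Module.finrank_eq_card_basis B
    have h2 := Module.finrank_eq_card_basis C
    simp only [Fintype.card_fin] at h1 h2
    omega
  subst hde
  let P : Matrix (Fin d) (Fin d) ℤ := B.toMatrix C
  have hP : ∀ j, c j = ∑ i, (P i j : ℝ) • b i := fun j => by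
    have h := B.sum_toMatrix_smul_self C j
    have h' := congrArg (Subtype.val) h
    rw [hC] at h'
    rw [← h', AddSubmonoidClass.coe_finsetSum]
    refine Finset.sum_congr rfl fun i _ => ?_
    rw [Int.cast_smul_eq_zsmul, ← hB]
    rfl
  have hdet : (P.map (Int.cast : ℤ → ℝ)).det ^ 2 = 1 := by
    have hu : IsUnit P.det := by
      have h := B.toMatrix_mul_toMatrix_flip C
      exact (Matrix.isUnit_iff_isUnit_det _).1 (.of_mul_eq_one _ h)
    have h2 : P.det ^ 2 = 1 := by
      rcases Int.isUnit_iff.1 hu with h | h <;> simp [h]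
    have h3 : (P.map (Int.cast : ℤ → ℝ)).det = (P.det : ℝ) :=
      ((Int.castRingHom ℝ).map_det P).symm
    rw [h3]
    exact_mod_cast h2
  have hG : (Matrix.gram ℝ c) =
      (P.map (Int.cast : ℤ → ℝ)).transpose *
        (Matrix.gram ℝ b) * P.map (Int.cast : ℤ → ℝ) := by
    ext i j
    simp only [Matrix.gram_apply, hP, sum_inner, inner_sum, real_inner_smul_left,
      real_inner_smul_right, Matrix.mul_apply, Matrix.transpose_apply, Matrix.map_apply,
      Finset.sum_mul]
    refine Finset.sum_congr rfl fun k _ => Finset.sum_congr rfl fun l _ => ?_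
    ring
  unfold gramVol
  rw [hG, Matrix.det_mul, Matrix.det_mul, Matrix.det_transpose]
  congr 1
  linear_combination (-(Matrix.gram ℝ b).det) * hdet

open Classical in
/-- The determinant `det(L) = √(det (BᵀB))` of a lattice, for any basis `B` of `L`
(and `0` if `L` is not a lattice). -/
def latticeDet {n : ℕ} (L : Submodule ℤ (E n)) : ℝ :=
  if h : IsLattice L then gramVol h.choose_spec.choose else 0

/-- The determinant may be computed from any basis. -/
theorem latticeDet_eq {n d : ℕ} {L : Submodule ℤ (E n)} {b : Fin d → E n}
    (hb : IsBasisOf b L) : latticeDet L = gramVol b := by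
  have h : IsLattice L := ⟨d, b, hb⟩
  rw [latticeDet, dif_pos h]
  exact gramVol_eq_of_isBasisOf h.choose_spec.choose_spec hb

/-- The dual lattice `L* = {y ∈ span(L) : ⟨y, x⟩ ∈ ℤ for all x ∈ L}`. -/
def dual {n : ℕ} (L : Submodule ℤ (E n)) : Submodule ℤ (E n) where
  carrier := {y | y ∈ Submodule.span ℝ (L : Set (E n)) ∧ ∀ x ∈ L, ∃ k : ℤ, inner ℝ y x = (k : ℝ)}
  zero_mem' := ⟨zero_mem _, fun x _ => ⟨0, by simp⟩⟩
  add_mem' := by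
    rintro y z ⟨hy, hy'⟩ ⟨hz, hz'⟩
    refine ⟨add_mem hy hz, fun x hx => ?_⟩
    obtain ⟨k, hk⟩ := hy' x hx
    obtain ⟨l, hl⟩ := hz' x hx
    exact ⟨k + l, by rw [inner_add_left, hk, hl]; push_cast; rfl⟩
  smul_mem' := by
    rintro m y ⟨hy, hy'⟩
    refine ⟨zsmul_mem hy m, fun x hx => ?_⟩
    obtain ⟨k, hk⟩ := hy' x hx
    refine ⟨m * k, ?_⟩
    rw [← Int.cast_smul_eq_zsmul ℝ m y, real_inner_smul_left, hk]
    push_cast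
    rfl

/-- `W` is a lattice subspace of `M`: it has a basis consisting of vectors of `M`. -/
def IsLatticeSubspace {n : ℕ} (M : Submodule ℤ (E n)) (W : Submodule ℝ (E n)) : Prop :=
  ∃ b : Module.Basis (Fin (Module.finrank ℝ W)) ℝ W, ∀ i, (b i : E n) ∈ M

/-- The lattice `M ∩ W`. -/
def slice {n : ℕ} (M : Submodule ℤ (E n)) (W : Submodule ℝ (E n)) : Submodule ℤ (E n) :=
  M ⊓ W.restrictScalars ℤ

/-- The covering radius `μ(L) = inf {r ≥ 0 : span(L) ⊆ L + r B}`, `B` the closed Euclidean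
unit ball. -/
def coveringRadius {n : ℕ} (L : Submodule ℤ (E n)) : ℝ≥0∞ :=
  ⨅ (r : ℝ≥0) (_ : ∀ x ∈ Submodule.span ℝ (L : Set (E n)), ∃ y ∈ L, ‖x - y‖ ≤ r), (r : ℝ≥0∞)

/-- `η_det(L)`: the maximum of `det(L* ∩ W) ^ (-1 / dim W)` over all lattice subspaces `W` of
`L*` of positive dimension. -/
def etaDet {n : ℕ} (L : Submodule ℤ (E n)) : ℝ≥0∞ :=
  ⨆ (W : Submodule ℝ (E n)) (_ : IsLatticeSubspace (dual L) W) (_ : 1 ≤ Module.finrank ℝ W),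
    ENNReal.ofReal (latticeDet (slice (dual L) W) ^ (-(1 / (Module.finrank ℝ W : ℝ))))

/-- The maximum of `√d · det(L* ∩ W) ^ (-1 / d)`, `d = dim W`, over all lattice subspaces `W` of
`L*` of positive dimension. -/
def klBound {n : ℕ} (L : Submodule ℤ (E n)) : ℝ≥0∞ :=
  ⨆ (W : Submodule ℝ (E n)) (_ : IsLatticeSubspace (dual L) W) (_ : 1 ≤ Module.finrank ℝ W),
    ENNReal.ofReal (Real.sqrt (Module.finrank ℝ W) *
      latticeDet (slice (dual L) W) ^ (-(1 / (Module.finrank ℝ W : ℝ))))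

/-- The image `R L` of `L` under a matrix `R`. -/
def matImage {n : ℕ} (R : Matrix (Fin n) (Fin n) ℝ) (L : Submodule ℤ (E n)) :
    Submodule ℤ (E n) :=
  L.map ((Matrix.toEuclideanLin R).restrictScalars ℤ)

/-- `η°_μ(L)`: the supremum of `μ(R L) / √(tr(Rᵀ R))` over all non-singular `R`. -/
def etaMuCirc {n : ℕ} (L : Submodule ℤ (E n)) : ℝ≥0∞ :=
  ⨆ (R : Matrix (Fin n) (Fin n) ℝ) (_ : R.det ≠ 0),
    coveringRadius (matImage R L) / ENNReal.ofReal (Real.sqrt (R.transpose * R).trace)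

/-- `C^det_(μ,∘)(n)`: the smallest `C` with `η°_μ(L) ≤ C · η_det(L)` for every `n`-dimensional
lattice `L ⊂ ℝⁿ`. -/
def detConst (n : ℕ) : ℝ≥0∞ :=
  sInf {C : ℝ≥0∞ | ∀ L : Submodule ℤ (E n), IsLatticeOfDim n L → etaMuCirc L ≤ C * etaDet L}

/-- `C_KL(n)`: the smallest `C` with
`μ(L) ≤ C · max_W √(dim W) · det(L* ∩ W) ^ (-1 / dim W)` for every lattice `L ⊂ ℝⁿ`. -/
def klConst (n : ℕ) : ℝ≥0∞ :=
  sInf {C : ℝ≥0∞ | ∀ L : Submodule ℤ (E n), IsLattice L → coveringRadius L ≤ C * klBound L}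

/-- `f(n) ≤ poly log n`. -/
def PolylogBounded (f : ℕ → ℝ≥0∞) : Prop :=
  ∃ (A : ℝ) (k : ℕ), ∀ n : ℕ, 2 ≤ n → f n ≤ ENNReal.ofReal (A * Real.log n ^ k)

/-- The `ℓ₂` Kannan–Lovász conjecture. -/
def KLConjecture : Prop := PolylogBounded klConst

end EuclLattice

end

/-!
Write `‖R‖` for `√tr (RᵀR)`. By AM–GM on the eigenvalues of a Gram matrix, `Rᵀ` multiplies the
squared volume of a `d`-dimensional parallelepiped by at most `(‖R‖ ^ 2 / d) ^ d`, and `Rᵀ` maps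
the dual of `R L` into `L*`. Hence the Kannan–Lovász bound of `R L` is at most `‖R‖ η_det(L)`, which
gives `C^det_(μ,∘) ≤ C_KL`.

For the other direction let `κ` be the Kannan–Lovász bound of `L`, so that `d` independent vectors
of `L*` have Gram determinant at least `(d / κ ^ 2) ^ d`. Take the canonical filtration of `L*`: its
first step is a sublattice of minimal slope `t = det ^ (2 / d)`, and one continues in the projection
of `L*` orthogonal to it. Rescaling the `j`-th direction of an adapted orthonormal basis by
`1 / √tⱼ` makes all slopes at least `1`, so for the lattice dual to the rescaled one `η_det ≤ 1`,
and undoing the rescaling bounds `μ(L)` by `C^det_(μ,∘) √(∑ⱼ 1 / tⱼ)`. The first `j + 1` directions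
lie in a step of slope at most `tⱼ`, so `1 / tⱼ ≤ κ ^ 2 / (j + 1)` and the harmonic sum costs only a
logarithm. Each step only has to be minimal up to a factor close to `1`, so attainment of the
minimum is never needed; the accumulated factor is kept below `2`, and enters the bound on `1 / tⱼ`.

Finiteness of `C_KL` follows from `μ(L) ≤ n η_det(L)`, obtained by rounding successively along short
vectors supplied by Minkowski's theorem.
-/

noncomputable section

namespace EuclLattice

variable {F : Type*} [NormedAddCommGroup F] [InnerProductSpace ℝ F]

section GramDet

variable {ι κ : Type*} [Fintype ι] [DecidableEq ι] [Fintype κ]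

/-- The Gram determinant of a finite family, i.e. the squared volume of the parallelepiped it
spans. -/
def gramDet (b : ι → F) : ℝ := (Matrix.gram ℝ b).det

theorem gramDet_nonneg (b : ι → F) : 0 ≤ gramDet b := (Matrix.posSemidef_gram ℝ b).det_nonneg

theorem gramDet_ne_zero_iff {b : ι → F} : gramDet b ≠ 0 ↔ LinearIndependent ℝ b :=
  Matrix.det_gram_ne_zero_iff_linearIndependent

theorem gramDet_pos {b : ι → F} (hb : LinearIndependent ℝ b) : 0 < gramDet b :=
  (gramDet_nonneg b).lt_of_ne' (gramDet_ne_zero_iff.2 hb)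

theorem gramDet_of_isEmpty [IsEmpty ι] (b : ι → F) : gramDet b = 1 := Matrix.det_isEmpty

theorem gramDet_fin_one (b : Fin 1 → F) : gramDet b = ‖b 0‖ ^ 2 := by
  simp [gramDet, Matrix.gram_apply]

theorem gramDet_comp_equiv [DecidableEq κ] (e : ι ≃ κ) (b : κ → F) :
    gramDet (b ∘ e) = gramDet b :=
  Matrix.det_submatrix_equiv_self e (Matrix.gram ℝ b)

theorem gramDet_of_orthonormal {b : ι → F} (hb : Orthonormal ℝ b) : gramDet b = 1 := by
  rw [gramDet, Matrix.gram_eq_one_iff_orthonormal.2 hb, Matrix.det_one]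

theorem gramDet_of_eq_sum_smul (P : Matrix ι ι ℝ) {b c : ι → F}
    (h : ∀ j, c j = ∑ i, P i j • b i) : gramDet c = P.det ^ 2 * gramDet b := by
  have gram_eq : Matrix.gram ℝ c = P.transpose * Matrix.gram ℝ b * P := by
    ext i j
    simp only [Matrix.gram_apply, h, sum_inner, inner_sum, real_inner_smul_left,
      real_inner_smul_right, Matrix.mul_apply, Matrix.transpose_apply, Finset.sum_mul]
    exact Finset.sum_congr rfl fun k _ => Finset.sum_congr rfl fun l _ => by ring
  rw [gramDet, gram_eq, Matrix.det_mul, Matrix.det_mul, Matrix.det_transpose, ← gramDet]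
  ring

theorem gramDet_smul (a : ℝ) (b : ι → F) :
    gramDet (fun i => a • b i) = (a ^ 2) ^ Fintype.card ι * gramDet b := by
  have h := gramDet_of_eq_sum_smul (a • (1 : Matrix ι ι ℝ)) (b := b) (c := fun i => a • b i)
    fun j => by simp [Matrix.one_apply]
  rw [h, Matrix.det_smul, Matrix.det_one]
  ring

theorem gramDet_sumElim_of_orthogonal [DecidableEq κ] {u : ι → F} {v : κ → F}
    (h : ∀ i j, inner ℝ (u i) (v j) = 0) :
    gramDet (Sum.elim u v) = gramDet u * gramDet v := by
  have gram_eq : Matrix.gram ℝ (Sum.elim u v) =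
      Matrix.fromBlocks (Matrix.gram ℝ u) 0 0 (Matrix.gram ℝ v) := by
    ext (i | i) (j | j)
    · simp [Matrix.gram_apply]
    · simp [Matrix.gram_apply, h]
    · simp [Matrix.gram_apply, real_inner_comm, h]
    · simp [Matrix.gram_apply]
  rw [gramDet, gram_eq, Matrix.det_fromBlocks_zero₂₁, gramDet, gramDet]

theorem gramDet_sumElim [DecidableEq κ] (u : ι → F) (v : κ → F)
    [(Submodule.span ℝ (Set.range u)).HasOrthogonalProjection] :
    gramDet (Sum.elim u v) = gramDet u *
      gramDet (fun j => (Submodule.span ℝ (Set.range u))ᗮ.starProjection (v j)) := by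
  set U := Submodule.span ℝ (Set.range u)
  have exists_coeff : ∀ j, ∃ x : ι → ℝ, ∑ i, x i • u i = U.starProjection (v j) := fun j =>
    (Submodule.mem_span_range_iff_exists_fun ℝ).1 (U.starProjection_apply_mem (v j))
  choose x hx using exists_coeff
  have shear : gramDet (Sum.elim u v) = gramDet (Sum.elim u fun j => Uᗮ.starProjection (v j)) := by
    rw [gramDet_of_eq_sum_smul (Matrix.fromBlocks 1 (Matrix.of fun i j => x j i) 0 1)
      (b := Sum.elim u fun j => Uᗮ.starProjection (v j))]
    · simp
    · rintro (j | j)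
      · simp [Matrix.one_apply]
      · simp [Matrix.one_apply, hx]
  rw [shear, gramDet_sumElim_of_orthogonal fun i j => ?_]
  exact Submodule.inner_right_of_mem_orthogonal (K := U)
    (Submodule.subset_span (Set.mem_range_self i)) (Uᗮ.starProjection_apply_mem _)

omit [DecidableEq ι] in
theorem exists_orthonormal_eq_sum_smul {b : ι → F} (hb : LinearIndependent ℝ b) :
    ∃ (f : ι → F) (P : Matrix ι ι ℝ), Orthonormal ℝ f ∧ ∀ j, b j = ∑ i, P i j • f i := by
  let W := Submodule.span ℝ (Set.range b)
  have : FiniteDimensional ℝ W := .span_of_finite ℝ (Set.finite_range b)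
  have finrank_W : Module.finrank ℝ W = Fintype.card ι := finrank_span_eq_card hb
  let f : OrthonormalBasis ι ℝ W := (stdOrthonormalBasis ℝ W).reindex
    (Fintype.equivOfCardEq (by simp [finrank_W]))
  let b' : ι → W := fun j => ⟨b j, Submodule.subset_span (Set.mem_range_self j)⟩
  refine ⟨fun i => f i, Matrix.of fun i j => f.repr (b' j) i,
    f.orthonormal.comp_linearIsometry W.subtypeₗᵢ, fun j => ?_⟩
  simpa [b'] using (congrArg Subtype.val (f.sum_repr (b' j))).symm

theorem det_le_trace_div_card_pow {A : Matrix ι ι ℝ} (hA : A.PosSemidef) :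
    A.det ≤ (A.trace / Fintype.card ι) ^ Fintype.card ι := by
  rcases isEmpty_or_nonempty ι with _ | _
  · simp
  rw [hA.1.det_eq_prod_eigenvalues, hA.1.trace_eq_sum_eigenvalues]
  simp only [RCLike.ofReal_real_eq_id, id_eq]
  set z := hA.1.eigenvalues
  have hz : ∀ i ∈ Finset.univ, 0 ≤ z i := fun i _ => hA.eigenvalues_nonneg i
  have amgm := Real.geom_mean_le_arith_mean Finset.univ (fun _ => (1 : ℝ)) z
    (fun _ _ => zero_le_one) (by simp [Fintype.card_pos]) hz
  simp only [Real.rpow_one, Finset.sum_const, Finset.card_univ, nsmul_eq_mul, mul_one,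
    one_mul] at amgm
  calc ∏ i, z i = ((∏ i, z i) ^ ((Fintype.card ι : ℝ)⁻¹)) ^ Fintype.card ι :=
        (Real.rpow_inv_natCast_pow (Finset.prod_nonneg hz) Fintype.card_ne_zero).symm
    _ ≤ _ := pow_le_pow_left₀ (Real.rpow_nonneg (Finset.prod_nonneg hz) _) amgm _

variable {G : Type*} [NormedAddCommGroup G] [InnerProductSpace ℝ G]

theorem gramDet_map_le_of_sum_norm_sq_le (T : F →ₗ[ℝ] G) {S : ℝ}
    (hS : ∀ f : ι → F, Orthonormal ℝ f → ∑ i, ‖T (f i)‖ ^ 2 ≤ S) (b : ι → F) :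
    gramDet (fun i => T (b i)) ≤ (S / Fintype.card ι) ^ Fintype.card ι * gramDet b := by
  by_cases hb : LinearIndependent ℝ b
  · obtain ⟨f, P, hf, hP⟩ := exists_orthonormal_eq_sum_smul hb
    have hTP : ∀ j, T (b j) = ∑ i, P i j • T (f i) := fun j => by simp [hP j]
    have trace_eq : (Matrix.gram ℝ fun i => T (f i)).trace = ∑ i, ‖T (f i)‖ ^ 2 := by
      simp [Matrix.trace, Matrix.gram_apply]
    have gramDet_f_le : gramDet (fun i => T (f i)) ≤
        (S / Fintype.card ι) ^ Fintype.card ι := by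
      refine (det_le_trace_div_card_pow (Matrix.posSemidef_gram ℝ _)).trans ?_
      rw [trace_eq]
      gcongr
      exact hS f hf
    rw [gramDet_of_eq_sum_smul P hTP, gramDet_of_eq_sum_smul P hP, gramDet_of_orthonormal hf,
      mul_one, mul_comm]
    gcongr
  · have h1 : gramDet b = 0 := not_not.1 fun h => hb (gramDet_ne_zero_iff.1 h)
    have h2 : gramDet (fun i => T (b i)) = 0 :=
      not_not.1 fun h => hb ((gramDet_ne_zero_iff.1 h).of_comp T)
    rw [h1, h2, mul_zero]

theorem gramDet_map_le_of_norm_le (T : F →ₗ[ℝ] G) (hT : ∀ x, ‖T x‖ ≤ ‖x‖) (b : ι → F) :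
    gramDet (fun i => T (b i)) ≤ gramDet b := by
  have hS : ∀ f : ι → F, Orthonormal ℝ f → ∑ i, ‖T (f i)‖ ^ 2 ≤ Fintype.card ι := fun f hf =>
    calc ∑ i, ‖T (f i)‖ ^ 2 ≤ ∑ _i : ι, (1 : ℝ) := Finset.sum_le_sum fun i _ =>
          pow_le_one₀ (norm_nonneg _) ((hT _).trans (hf.1 i).le)
      _ = Fintype.card ι := by simp
  refine (gramDet_map_le_of_sum_norm_sq_le T hS b).trans_eq ?_
  rcases isEmpty_or_nonempty ι with _ | _
  · simp
  · rw [div_self (by simp), one_pow, one_mul]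

theorem gramDet_map_le_of_norm_sq_le_sum_inner_sq (T : F →ₗ[ℝ] G) {l : κ → F}
    (hT : ∀ x, ‖T x‖ ^ 2 ≤ ∑ k, inner ℝ (l k) x ^ 2) (b : ι → F) :
    gramDet (fun i => T (b i)) ≤
      ((∑ k, ‖l k‖ ^ 2) / Fintype.card ι) ^ Fintype.card ι * gramDet b := by
  refine gramDet_map_le_of_sum_norm_sq_le T (fun f hf => ?_) b
  have bessel : ∀ k, ∑ i, inner ℝ (l k) (f i) ^ 2 ≤ ‖l k‖ ^ 2 := fun k => by
    simpa only [Real.norm_eq_abs, sq_abs, real_inner_comm] using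
      hf.sum_inner_products_le (l k) (s := Finset.univ)
  calc ∑ i, ‖T (f i)‖ ^ 2 ≤ ∑ i, ∑ k, inner ℝ (l k) (f i) ^ 2 :=
        Finset.sum_le_sum fun i _ => hT (f i)
    _ = ∑ k, ∑ i, inner ℝ (l k) (f i) ^ 2 := Finset.sum_comm
    _ ≤ ∑ k, ‖l k‖ ^ 2 := Finset.sum_le_sum fun k _ => bessel k

theorem gramDet_mul_gramDet_starProjection_le [FiniteDimensional ℝ F] [DecidableEq κ]
    (V : Submodule ℝ F) {u : ι → F} (hu : ∀ i, u i ∈ V) (v : κ → F) :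
    gramDet u * gramDet (fun j => Vᗮ.starProjection (v j)) ≤ gramDet (Sum.elim u v) := by
  rw [gramDet_sumElim]
  refine mul_le_mul_of_nonneg_left ?_ (gramDet_nonneg u)
  set U := Submodule.span ℝ (Set.range u)
  have hUV : U ≤ V := Submodule.span_le.2 (Set.range_subset_iff.2 hu)
  have proj_proj : ∀ x, Vᗮ.starProjection (Uᗮ.starProjection x) = Vᗮ.starProjection x :=
    DFunLike.congr_fun
      (Submodule.starProjection_comp_starProjection_of_le (Submodule.orthogonal_le hUV))
  simpa only [ContinuousLinearMap.coe_coe, proj_proj] using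
    gramDet_map_le_of_norm_le (Vᗮ.starProjection : F →ₗ[ℝ] F)
      (Vᗮ.norm_starProjection_apply_le ·) fun j => Uᗮ.starProjection (v j)

theorem gramDet_le_gramDet_of_mem_span {u c : ι → F} (hc : LinearIndependent ℤ c)
    (h : ∀ j, c j ∈ Submodule.span ℤ (Set.range u)) : gramDet u ≤ gramDet c := by
  choose x hx using fun j => (Submodule.mem_span_range_iff_exists_fun ℤ).1 (h j)
  let P : Matrix ι ι ℤ := Matrix.of fun i j => x j i
  have det_ne_zero : P.det ≠ 0 := fun hdet => by
    obtain ⟨w, hw, hPw⟩ := Matrix.exists_mulVec_eq_zero_iff.2 hdet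
    refine hw (funext (Fintype.linearIndependent_iff.1 hc w ?_))
    calc ∑ j, w j • c j = ∑ i, (P.mulVec w) i • u i := by
          simp only [← hx, Finset.smul_sum, smul_smul, Matrix.mulVec, dotProduct, P,
            Matrix.of_apply, Finset.sum_smul]
          rw [Finset.sum_comm]
          simp only [mul_comm]
      _ = 0 := by simp [hPw]
  have hP : ∀ j, c j = ∑ i, P.map (Int.cast : ℤ → ℝ) i j • u i := fun j => by
    simp [P, ← hx, Int.cast_smul_eq_zsmul]
  have one_le_det_sq : (1 : ℝ) ≤ (P.map (Int.cast : ℤ → ℝ)).det ^ 2 := by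
    rw [show (P.map (Int.cast : ℤ → ℝ)).det = P.det from ((Int.castRingHom ℝ).map_det P).symm]
    exact_mod_cast (sq_pos_of_ne_zero det_ne_zero : 0 < P.det ^ 2)
  rw [gramDet_of_eq_sum_smul _ hP]
  exact le_mul_of_one_le_left (gramDet_nonneg u) one_le_det_sq

theorem one_le_gramDet_of_inner_int {c : ι → F} (hc : LinearIndependent ℤ c)
    (h : ∀ i j, ∃ z : ℤ, inner ℝ (c i) (c j) = z) : 1 ≤ gramDet c := by
  choose Q hQ using h
  have gram_eq : Matrix.gram ℝ c = (Matrix.of Q).map (Int.cast : ℤ → ℝ) := Matrix.ext hQ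
  have gramDet_eq : gramDet c = (Matrix.of Q).det := by
    rw [gramDet, gram_eq]
    exact ((Int.castRingHom ℝ).map_det (Matrix.of Q)).symm
  have det_ne_zero : (Matrix.of Q).det ≠ 0 := fun hdet => by
    obtain ⟨w, hw, hQw⟩ := Matrix.exists_mulVec_eq_zero_iff.2 hdet
    refine hw (funext (Fintype.linearIndependent_iff.1 hc w ?_))
    have inner_eq_zero : ∀ i, inner ℝ (c i) (∑ j, w j • c j) = 0 := fun i => by
      have := congrArg (Int.cast : ℤ → ℝ) (congrFun hQw i)
      simpa [Matrix.mulVec, dotProduct, inner_sum, ← Int.cast_smul_eq_zsmul ℝ,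
        real_inner_smul_right, hQ, mul_comm] using this
    rw [← inner_self_eq_zero (𝕜 := ℝ)]
    conv_lhs =>
      enter [2]
      rw [← Finset.sum_congr rfl fun i _ => Int.cast_smul_eq_zsmul ℝ (w i) (c i)]
    simp [sum_inner, real_inner_smul_left, inner_eq_zero]
  have := gramDet_nonneg c
  rw [gramDet_eq] at this ⊢
  have det_nonneg : 0 ≤ (Matrix.of Q).det := by exact_mod_cast this
  exact_mod_cast (show 1 ≤ (Matrix.of Q).det by omega)

end GramDet

section SlopeGE

/-- `M` has slope at least `t`: every `ℤ`-independent family of `d` vectors of `M` has Gram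
determinant at least `t ^ d`. Submodules and projections of `M` are covered by this notion even
when they are not known to be lattices. -/
def SlopeGE (t : ℝ) (M : Submodule ℤ F) : Prop :=
  ∀ (d : ℕ) (c : Fin d → F), (∀ i, c i ∈ M) → LinearIndependent ℤ c → t ^ d ≤ gramDet c

namespace SlopeGE

variable {M N : Submodule ℤ F} {t : ℝ}

theorem mono (hN : SlopeGE t N) (h : M ≤ N) : SlopeGE t M :=
  fun d c hc hci => hN d c (fun i => h (hc i)) hci

theorem linearIndependent (ht : 0 < t) (hM : SlopeGE t M) {d : ℕ} {c : Fin d → F}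
    (hc : ∀ i, c i ∈ M) (hci : LinearIndependent ℤ c) : LinearIndependent ℝ c :=
  gramDet_ne_zero_iff.1 ((pow_pos ht d).trans_le (hM d c hc hci)).ne'

theorem le_norm_sq (hM : SlopeGE t M) {x : F} (hx : x ∈ M) (hx0 : x ≠ 0) : t ≤ ‖x‖ ^ 2 := by
  have : Module.IsTorsionFree ℤ F := .trans_faithfulSMul ℤ ℝ F
  simpa [gramDet_fin_one] using
    hM 1 (fun _ => x) (fun _ => hx) (LinearIndependent.of_subsingleton 0 hx0)

theorem map_smul {a : ℝ} (ha : a ≠ 0) (hM : SlopeGE t M) :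
    SlopeGE (a ^ 2 * t) (M.map ((LinearMap.lsmul ℝ F a).restrictScalars ℤ)) := by
  intro d c hc hci
  choose x hxM hx using hc
  have hx_indep : LinearIndependent ℤ x :=
    LinearIndependent.of_comp ((LinearMap.lsmul ℝ F a).restrictScalars ℤ)
      (by simpa only [Function.comp_def, hx] using hci)
  have hcx : c = fun i => a • x i := funext fun i => (hx i).symm
  rw [hcx, gramDet_smul, mul_pow, Fintype.card_fin]
  gcongr
  exact hM d x hxM hx_indep

end SlopeGE

theorem slopeGE_inv_of_inner_int {κ : Type*} [Fintype κ] {M : Submodule ℤ F} (l : κ → F)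
    (hl : ∀ x ∈ M, (∀ k, inner ℝ (l k) x = 0) → x = 0)
    (h_int : ∀ x ∈ M, ∀ k, ∃ z : ℤ, inner ℝ (l k) x = z) {S : ℝ} (hS : 0 < S)
    (hlS : ∑ k, ‖l k‖ ^ 2 ≤ S) : SlopeGE S⁻¹ M := by
  intro d c hc hci
  let T : F →ₗ[ℝ] EuclideanSpace ℝ κ :=
    (WithLp.linearEquiv 2 ℝ (κ → ℝ)).symm.toLinearMap ∘ₗ LinearMap.pi fun k => innerₛₗ ℝ (l k)
  have T_apply : ∀ x k, T x k = inner ℝ (l k) x := fun x k => by simp [T]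
  have T_indep : LinearIndependent ℤ fun i => T (c i) := by
    refine Fintype.linearIndependent_iff.2 fun g hg => Fintype.linearIndependent_iff.1 hci g ?_
    refine hl _ (sum_mem fun i _ => M.smul_mem _ (hc i)) fun k => ?_
    simpa [← T_apply, ← Int.cast_smul_eq_zsmul ℝ] using congrArg (· k) hg
  have one_le : 1 ≤ gramDet fun i => T (c i) := by
    refine one_le_gramDet_of_inner_int T_indep fun i j => ?_
    choose z hz using fun i => h_int (c i) (hc i)
    exact ⟨∑ k, z i k * z j k, by simp [PiLp.inner_apply, T_apply, hz, mul_comm]⟩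
  have gramDet_T_le := gramDet_map_le_of_norm_sq_le_sum_inner_sq T (l := l)
    (fun x => by simp [EuclideanSpace.norm_sq_eq, T_apply]) c
  rw [inv_pow, inv_le_iff_one_le_mul₀' (pow_pos hS d)]
  refine (one_le.trans gramDet_T_le).trans ?_
  rw [Fintype.card_fin]
  have := gramDet_nonneg c
  rcases Nat.eq_zero_or_pos d with rfl | hd
  · simp
  · gcongr
    exact (div_le_self (by positivity) (by exact_mod_cast hd)).trans hlS

section Projection

variable [FiniteDimensional ℝ F]

/-- The orthogonal projection onto `Vᗮ`, as a `ℤ`-linear map: the image of a lattice under it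
plays the role of the quotient of the lattice by its intersection with `V`. -/
def orthProj (V : Submodule ℝ F) : F →ₗ[ℤ] F :=
  (Vᗮ.starProjection : F →ₗ[ℝ] F).restrictScalars ℤ

@[simp]
theorem orthProj_apply (V : Submodule ℝ F) (x : F) : orthProj V x = Vᗮ.starProjection x := rfl

theorem orthProj_eq_zero_iff {V : Submodule ℝ F} {x : F} : orthProj V x = 0 ↔ x ∈ V := by
  rw [orthProj_apply, Submodule.starProjection_apply_eq_zero_iff, Submodule.orthogonal_orthogonal]

theorem orthProj_eq_self_iff {V : Submodule ℝ F} {x : F} : orthProj V x = x ↔ x ∈ Vᗮ := by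
  rw [orthProj_apply, Submodule.starProjection_eq_self_iff]

theorem exists_split_along_subspace {M : Submodule ℤ F} (V : Submodule ℝ F) {d : ℕ}
    {c : Fin d → F} (hc : ∀ i, c i ∈ M) (hci : LinearIndependent ℤ c) :
    ∃ (k m : ℕ) (u : Fin k → F) (v : Fin m → F), k + m = d ∧
      (∀ i, u i ∈ M ⊓ V.restrictScalars ℤ) ∧ LinearIndependent ℤ u ∧
      (∀ j, v j ∈ M.map (orthProj V)) ∧ LinearIndependent ℤ v ∧
      gramDet u * gramDet v ≤ gramDet c := by
  let N := Submodule.span ℤ (Set.range c)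
  have hNM : N ≤ M := Submodule.span_le.2 (Set.range_subset_iff.2 hc)
  let bN : Module.Basis (Fin d) ℤ N := Module.Basis.span hci
  have : Module.Finite ℤ N := .of_basis bN
  let p : N →ₗ[ℤ] F := orthProj V ∘ₗ N.subtype
  let K := LinearMap.ker p
  have : Module.IsTorsionFree ℤ F := .trans_faithfulSMul ℤ ℝ F
  have : Module.IsTorsionFree ℤ (N ⧸ K) :=
    (LinearMap.quotKerEquivRange p).injective.moduleIsTorsionFree _ (fun a x => map_smul _ a x)
  let bK := Module.finBasis ℤ K
  let bQ := Module.finBasis ℤ (N ⧸ K)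
  let B := bK.sumQuot bQ
  let e := bN.indexEquiv B
  have card_eq := Fintype.card_congr e
  rw [Fintype.card_fin, Fintype.card_sum, Fintype.card_fin, Fintype.card_fin] at card_eq
  let u := fun i => (B (Sum.inl i) : F)
  let v := fun j => (B (Sum.inr j) : F)
  have hu : ∀ i, u i ∈ V := fun i => orthProj_eq_zero_iff.1 <| show p (B (Sum.inl i)) = 0 by
    have : B (Sum.inl i) = bK i := Module.Basis.sumQuot_inl bK bQ i
    rw [this]
    exact (bK i).2
  have hv : ∀ j, orthProj V (v j) = K.liftQ p le_rfl (bQ j) := fun j => by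
    rw [← Module.Basis.sumQuot_inr bK bQ j, Submodule.liftQ_apply]
    rfl
  refine ⟨_, _, u, fun j => orthProj V (v j), card_eq.symm, fun i => ⟨hNM (B _).2, hu i⟩,
    (B.linearIndependent.comp _ Sum.inl_injective).map' N.subtype (Submodule.ker_subtype N),
    fun j => ⟨v j, hNM (B _).2, rfl⟩, ?_,
    (gramDet_mul_gramDet_starProjection_le V hu v).trans ?_⟩
  · simp only [hv]
    exact bQ.linearIndependent.map' (K.liftQ p le_rfl) (Submodule.ker_liftQ_eq_bot _ _ _ le_rfl)
  · rw [← gramDet_comp_equiv e]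
    refine gramDet_le_gramDet_of_mem_span hci fun j => ?_
    have range_B : Set.range (Sum.elim u v ∘ e) = N.subtype '' Set.range B := by
      rw [e.surjective.range_comp, ← Set.range_comp, ← Sum.elim_comp_inl_inr (N.subtype ∘ B)]
      rfl
    rw [range_B, Submodule.span_image, B.span_eq, Submodule.map_top, Submodule.range_subtype]
    exact Submodule.subset_span (Set.mem_range_self j)

theorem SlopeGE.of_inf_of_map {M : Submodule ℤ F} {t : ℝ} (ht : 0 ≤ t) (V : Submodule ℝ F)
    (h_inf : SlopeGE t (M ⊓ V.restrictScalars ℤ)) (h_map : SlopeGE t (M.map (orthProj V))) :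
    SlopeGE t M := by
  intro d c hc hci
  obtain ⟨k, m, u, v, rfl, hu, hui, hv, hvi, h⟩ := exists_split_along_subspace V hc hci
  calc t ^ (k + m) = t ^ k * t ^ m := pow_add t k m
    _ ≤ gramDet u * gramDet v := by
      have := gramDet_nonneg u
      gcongr
      exacts [h_inf k u hu hui, h_map m v hv hvi]
    _ ≤ gramDet c := h

theorem exists_lift_of_map_orthProj {M : Submodule ℤ F} {k d : ℕ} {b : Fin k → F}
    (hb : ∀ i, b i ∈ M) (hbi : LinearIndependent ℤ b) {c : Fin d → F}
    (hc : ∀ i, c i ∈ M.map (orthProj (Submodule.span ℝ (Set.range b))))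
    (hci : LinearIndependent ℤ c) :
    ∃ c' : Fin (k + d) → F, (∀ i, c' i ∈ M) ∧ LinearIndependent ℤ c' ∧
      gramDet c' = gramDet b * gramDet c := by
  set V := Submodule.span ℝ (Set.range b)
  choose v hvM hv using hc
  have proj_b : ∀ i, orthProj V (b i) = 0 := fun i =>
    orthProj_eq_zero_iff.2 (Submodule.subset_span (Set.mem_range_self i))
  have sum_indep : LinearIndependent ℤ (Sum.elim b v) := by
    refine Fintype.linearIndependent_iff.2 fun g hg => ?_
    simp only [Fintype.sum_sum_type, Sum.elim_inl, Sum.elim_inr] at hg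
    have coeff_v := Fintype.linearIndependent_iff.1 hci (fun j => g (Sum.inr j)) (by
      simpa [proj_b, hv, -orthProj_apply] using congrArg (orthProj V) hg)
    have coeff_b := Fintype.linearIndependent_iff.1 hbi (fun i => g (Sum.inl i)) (by
      simpa [coeff_v] using hg)
    exact Sum.rec coeff_b coeff_v
  refine ⟨Sum.elim b v ∘ finSumFinEquiv.symm, fun i => ?_, sum_indep.comp _ (Equiv.injective _), ?_⟩
  · exact Sum.rec (motive := fun s => Sum.elim b v s ∈ M) hb hvM (finSumFinEquiv.symm i)
  · rw [gramDet_comp_equiv, gramDet_sumElim]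
    exact congrArg (gramDet b * gramDet ·) (funext hv)

end Projection

theorem SlopeGE.exists_maximal {M : Submodule ℤ F} {c₀ : ℝ} (hc₀ : 0 ≤ c₀) (hM : SlopeGE c₀ M)
    (hM0 : M ≠ ⊥) : ∃ t, c₀ ≤ t ∧ SlopeGE t M ∧ ∀ s, t < s → ¬SlopeGE s M := by
  let S := {s : ℝ | 0 ≤ s ∧ SlopeGE s M}
  obtain ⟨x, hx, hx0⟩ := Submodule.exists_mem_ne_zero_of_ne_bot hM0
  have S_bdd : BddAbove S := ⟨‖x‖ ^ 2, fun s hs => hs.2.le_norm_sq hx hx0⟩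
  have S_closed : IsClosed S := by
    simp only [S, SlopeGE, Set.ofPred_and, Set.ofPred_forall]
    refine isClosed_Ici.inter ?_
    exact isClosed_iInter fun d => isClosed_iInter fun c => isClosed_iInter fun _ =>
      isClosed_iInter fun _ => isClosed_le (continuous_pow d) continuous_const
  obtain ⟨h0, h⟩ := S_closed.csSup_mem ⟨c₀, hc₀, hM⟩ S_bdd
  exact ⟨sSup S, le_csSup S_bdd ⟨hc₀, hM⟩, h, fun s hs hsM =>
    hs.not_ge (le_csSup S_bdd ⟨h0.trans hs.le, hsM⟩)⟩

end SlopeGE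

section SlopeScaling

theorem span_range_coe_basis {R V ι : Type*} [Ring R] [AddCommGroup V] [Module R V]
    {W : Submodule R V} (b : Module.Basis ι R W) :
    Submodule.span R (Set.range fun i => (b i : V)) = W := by
  have span_b := congrArg (Submodule.map W.subtype) b.span_eq
  rwa [Submodule.map_span, ← Set.range_comp, Submodule.map_subtype_top] at span_b

theorem span_range_append {R V : Type*} [Ring R] [AddCommGroup V] [Module R V] {k m : ℕ}
    (e : Fin k → V) (f : Fin m → V) : Submodule.span R (Set.range (Fin.append e f)) =
      Submodule.span R (Set.range e) ⊔ Submodule.span R (Set.range f) := by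
  rw [← Submodule.span_union, ← Set.Sum.elim_range, ← Fin.append_comp_sumElim]
  exact congrArg _ (finSumFinEquiv.surjective.range_comp _).symm

theorem span_map_orthProj_le_orthogonal [FiniteDimensional ℝ F] (M : Submodule ℤ F)
    (V : Submodule ℝ F) : Submodule.span ℝ (M.map (orthProj V) : Set F) ≤ Vᗮ := by
  rw [Submodule.span_le]
  rintro _ ⟨x, _, rfl⟩
  exact Vᗮ.starProjection_apply_mem x

theorem sup_span_map_orthProj [FiniteDimensional ℝ F] {M : Submodule ℤ F} {V : Submodule ℝ F}
    (hV : V ≤ Submodule.span ℝ (M : Set F)) :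
    V ⊔ Submodule.span ℝ (M.map (orthProj V) : Set F) = Submodule.span ℝ (M : Set F) := by
  apply le_antisymm
  · refine sup_le hV (Submodule.span_le.2 ?_)
    rintro _ ⟨x, hx, rfl⟩
    rw [orthProj_apply, Submodule.starProjection_orthogonal_val]
    exact sub_mem (Submodule.subset_span hx) (hV (V.starProjection_apply_mem x))
  · refine Submodule.span_le.2 fun x hx => ?_
    rw [SetLike.mem_coe, ← V.starProjection_add_starProjection_orthogonal x]
    exact Submodule.add_mem_sup (V.starProjection_apply_mem x) (Submodule.subset_span ⟨x, hx, rfl⟩)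

theorem finrank_add_finrank_span_map_orthProj [FiniteDimensional ℝ F] {M : Submodule ℤ F}
    {V : Submodule ℝ F} (hV : V ≤ Submodule.span ℝ (M : Set F)) :
    Module.finrank ℝ V + Module.finrank ℝ (Submodule.span ℝ (M.map (orthProj V) : Set F)) =
      Module.finrank ℝ (Submodule.span ℝ (M : Set F)) := by
  have disjoint : V ⊓ Submodule.span ℝ (M.map (orthProj V) : Set F) = ⊥ :=
    (V.orthogonal_disjoint.mono_right (span_map_orthProj_le_orthogonal M V)).eq_bot
  rw [← Submodule.finrank_sup_add_finrank_inf_eq, disjoint, finrank_bot, add_zero,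
    sup_span_map_orthProj hV]

theorem SlopeGE.of_scaling_orthProj [FiniteDimensional ℝ F] {M : Submodule ℤ F}
    {V : Submodule ℝ F} {t : ℝ} (ht : 0 < t) (hM : SlopeGE t M) {A B : F →ₗ[ℝ] F}
    (hB : ∀ x, B x = (√t)⁻¹ • V.starProjection x + A (orthProj V x))
    (hAV : ∀ x ∈ M.map (orthProj V), A x ∈ Vᗮ) (hA0 : ∀ x ∈ M.map (orthProj V), A x = 0 → x = 0)
    (hA : SlopeGE 1 ((M.map (orthProj V)).map (A.restrictScalars ℤ))) :
    SlopeGE 1 (M.map (B.restrictScalars ℤ)) := by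
  have proj_B : ∀ x ∈ M, orthProj V (B x) = A (orthProj V x) := fun x hx => by
    have h1 : orthProj V ((√t)⁻¹ • V.starProjection x) = 0 :=
      orthProj_eq_zero_iff.2 (V.smul_mem _ (V.starProjection_apply_mem x))
    rw [hB, map_add, h1, zero_add]
    exact orthProj_eq_self_iff.2 (hAV _ (Submodule.mem_map_of_mem hx))
  have hscale : SlopeGE 1 (M.map ((LinearMap.lsmul ℝ F (√t)⁻¹).restrictScalars ℤ)) := by
    have := hM.map_smul (inv_ne_zero (Real.sqrt_pos.2 ht).ne')
    rwa [inv_pow, Real.sq_sqrt ht.le, inv_mul_cancel₀ ht.ne'] at this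
  refine SlopeGE.of_inf_of_map zero_le_one V (hscale.mono ?_) (hA.mono ?_)
  · rintro _ ⟨⟨x, hx, rfl⟩, hBx⟩
    have proj_x : orthProj V x = 0 :=
      hA0 _ ⟨x, hx, rfl⟩ ((proj_B x hx).symm.trans (orthProj_eq_zero_iff.2 hBx))
    refine ⟨x, hx, ?_⟩
    change (√t)⁻¹ • x = B x
    rw [hB, proj_x, map_zero, add_zero,
      Submodule.starProjection_eq_self_iff.2 (orthProj_eq_zero_iff.1 proj_x)]
  · rintro _ ⟨_, ⟨x, hx, rfl⟩, rfl⟩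
    exact ⟨orthProj V x, ⟨x, hx, rfl⟩, (proj_B x hx).symm⟩

theorem map_mem_span_and_eq_zero_of_eigenvectors {ι : Type*} [Finite ι] {e : ι → F}
    (he : LinearIndependent ℝ e) {A : F →ₗ[ℝ] F} {a : ι → ℝ} (ha : ∀ i, a i ≠ 0)
    (hA : ∀ i, A (e i) = a i • e i) {x : F} (hx : x ∈ Submodule.span ℝ (Set.range e)) :
    A x ∈ Submodule.span ℝ (Set.range e) ∧ (A x = 0 → x = 0) := by
  cases nonempty_fintype ι
  obtain ⟨r, rfl⟩ := (Submodule.mem_span_range_iff_exists_fun ℝ).1 hx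
  have A_sum : A (∑ i, r i • e i) = ∑ i, (r i * a i) • e i := by simp [hA, smul_smul]
  rw [A_sum]
  refine ⟨(Submodule.mem_span_range_iff_exists_fun ℝ).2 ⟨_, rfl⟩, fun h => ?_⟩
  have hr := Fintype.linearIndependent_iff.1 he _ h
  exact Finset.sum_eq_zero fun i _ => by simp [(mul_eq_zero.1 (hr i)).resolve_right (ha i)]

theorem orthonormal_append {k m : ℕ} {e : Fin k → F} {f : Fin m → F} (he : Orthonormal ℝ e)
    (hf : Orthonormal ℝ f) (h : ∀ i j, inner ℝ (e i) (f j) = 0) :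
    Orthonormal ℝ (Fin.append e f) := by
  rw [orthonormal_iff_ite] at *
  refine Fin.addCases (fun i => ?_) (fun i => ?_) <;>
    refine Fin.addCases (fun j => ?_) (fun j => ?_)
  · simp [he]
  · simp [h, Fin.ext_iff]; omega
  · simp [real_inner_comm, h, Fin.ext_iff]; omega
  · simp [hf]

/-- The linear map `A` scales the orthonormal basis `e` of the span of `M` by the factors
`1 / √tⱼ` so that the image of `M` has slope at least `1`, and each `tⱼ` is optimal up to the
factor `θ`: some independent family of more than `j` vectors of `M` has slope at most `θ tⱼ`. The
values of `A` outside the span of `M` are irrelevant. -/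
structure IsSlopeScaling (θ : ℝ) (M : Submodule ℤ F) {n : ℕ} (e : Fin n → F) (t : Fin n → ℝ)
    (A : F →ₗ[ℝ] F) : Prop where
  orthonormal : Orthonormal ℝ e
  span_eq : Submodule.span ℝ (Set.range e) = Submodule.span ℝ (M : Set F)
  pos : ∀ j, 0 < t j
  map_apply : ∀ j, A (e j) = (√(t j))⁻¹ • e j
  slopeGE_map : SlopeGE 1 (M.map (A.restrictScalars ℤ))
  exists_gramDet_le : ∀ j : Fin n, ∃ (d : ℕ) (c : Fin d → F), (j : ℕ) < d ∧ (∀ i, c i ∈ M) ∧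
    LinearIndependent ℤ c ∧ gramDet c ≤ (θ * t j) ^ d

theorem IsSlopeScaling.map_mem_span_and_eq_zero {θ : ℝ} {M : Submodule ℤ F} {n : ℕ} {e : Fin n → F}
    {t : Fin n → ℝ} {A : F →ₗ[ℝ] F} (h : IsSlopeScaling θ M e t A) {x : F}
    (hx : x ∈ Submodule.span ℝ (M : Set F)) :
    A x ∈ Submodule.span ℝ (M : Set F) ∧ (A x = 0 → x = 0) := by
  rw [← h.span_eq] at hx ⊢
  exact map_mem_span_and_eq_zero_of_eigenvectors h.orthonormal.linearIndependent
    (fun j => (inv_pos.2 (Real.sqrt_pos.2 (h.pos j))).ne') h.map_apply hx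

theorem IsSlopeScaling.norm_map_sq {θ : ℝ} {M : Submodule ℤ F} {n : ℕ} {e : Fin n → F}
    {t : Fin n → ℝ} {A : F →ₗ[ℝ] F} (h : IsSlopeScaling θ M e t A) (j : Fin n) :
    ‖A (e j)‖ ^ 2 = (t j)⁻¹ := by
  rw [h.map_apply, norm_smul, h.orthonormal.1, mul_one, Real.norm_eq_abs, sq_abs, inv_pow,
    Real.sq_sqrt (h.pos j).le]

theorem IsSlopeScaling.of_span_eq_bot {M : Submodule ℤ F}
    (hM : Submodule.span ℝ (M : Set F) = ⊥) (θ : ℝ) (e : Fin 0 → F) (t : Fin 0 → ℝ) :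
    IsSlopeScaling θ M e t 0 where
  orthonormal := ⟨fun i => i.elim0, fun i => i.elim0⟩
  span_eq := by simp [hM]
  pos := fun i => i.elim0
  map_apply := fun i => i.elim0
  slopeGE_map := by
    rintro (_ | d) c hc hci
    · simp [gramDet_of_isEmpty]
    · obtain ⟨x, -, hx⟩ := hc 0
      exact absurd hx.symm (hci.ne_zero 0)
  exists_gramDet_le := fun i => i.elim0

theorem SlopeGE.le_of_gramDet_le_pow {M : Submodule ℤ F} {s r : ℝ} (hM : SlopeGE s M)
    (hr : 0 ≤ r) {d : ℕ} (hd : d ≠ 0) {c : Fin d → F} (hc : ∀ i, c i ∈ M)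
    (hci : LinearIndependent ℤ c) (h : gramDet c ≤ r ^ d) : s ≤ r :=
  le_of_pow_le_pow_left₀ hd hr ((hM d c hc hci).trans h)

theorem SlopeGE.map_orthProj [FiniteDimensional ℝ F] {M : Submodule ℤ F} {t δ : ℝ} (ht : 0 < t)
    (hδ : 1 ≤ δ) (hM : SlopeGE t M) {k : ℕ} {b : Fin k → F} (hbM : ∀ i, b i ∈ M)
    (hbi : LinearIndependent ℤ b) (hb : gramDet b ≤ (δ * t) ^ k) :
    SlopeGE (t / δ ^ k) (M.map (orthProj (Submodule.span ℝ (Set.range b)))) := by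
  intro d c hc hci
  obtain ⟨c', hc'M, hc'i, hc'⟩ := exists_lift_of_map_orthProj hbM hbi hc hci
  rcases eq_or_ne d 0 with rfl | hd
  · simp [gramDet_of_isEmpty]
  have : 0 < δ := one_pos.trans_le hδ
  have hc0 := gramDet_nonneg c
  have key : t ^ k * t ^ d ≤ t ^ k * (δ ^ k * gramDet c) := calc
    t ^ k * t ^ d ≤ gramDet b * gramDet c := by rw [← pow_add, ← hc']; exact hM _ c' hc'M hc'i
    _ ≤ (δ * t) ^ k * gramDet c := by gcongr
    _ = t ^ k * (δ ^ k * gramDet c) := by rw [mul_pow]; ring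
  rw [div_pow, div_le_iff₀ (by positivity), mul_comm]
  calc t ^ d ≤ δ ^ k * gramDet c := le_of_mul_le_mul_left key (by positivity)
    _ ≤ (δ ^ k) ^ d * gramDet c := by
      gcongr
      exact le_self_pow₀ (one_le_pow₀ hδ) hd

theorem SlopeGE.exists_gramDet_le_of_map_orthProj [FiniteDimensional ℝ F] {M : Submodule ℤ F}
    {t δ : ℝ} (hM : SlopeGE t M) (ht : 0 < t) (hδ : 1 ≤ δ) {k : ℕ} {b : Fin k → F}
    (hbM : ∀ i, b i ∈ M) (hbi : LinearIndependent ℤ b) (hb : gramDet b ≤ (δ * t) ^ k) {s : ℝ}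
    (hs : 0 < s) {d : ℕ} (hd : d ≠ 0) {c : Fin d → F}
    (hc : ∀ i, c i ∈ M.map (orthProj (Submodule.span ℝ (Set.range b))))
    (hci : LinearIndependent ℤ c) (hct : gramDet c ≤ s ^ d) :
    ∃ c' : Fin (k + d) → F, (∀ i, c' i ∈ M) ∧ LinearIndependent ℤ c' ∧
      gramDet c' ≤ (δ ^ (k + 1) * s) ^ (k + d) := by
  obtain ⟨c', hc'M, hc'i, hc'⟩ := exists_lift_of_map_orthProj hbM hbi hc hci
  have : 0 < δ := one_pos.trans_le hδ
  have t_le : t / δ ^ k ≤ s :=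
    (hM.map_orthProj ht hδ hbM hbi hb).le_of_gramDet_le_pow hs.le hd hc hci hct
  have δt_le : δ * t ≤ δ ^ (k + 1) * s := calc
    δ * t ≤ δ * (s * δ ^ k) := by
      gcongr
      exact (div_le_iff₀ (by positivity)).1 t_le
    _ = δ ^ (k + 1) * s := by ring
  refine ⟨c', hc'M, hc'i, ?_⟩
  rw [hc', pow_add]
  refine mul_le_mul (hb.trans (by gcongr)) (hct.trans ?_) (gramDet_nonneg c) (by positivity)
  gcongr
  exact le_mul_of_one_le_left hs.le (one_le_pow₀ hδ)

/-- The inductive step for the slope filtration: the first block of the filtration is spanned by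
a family `b` of nearly minimal slope, and the projection of `M` along it is scaled
recursively. -/
theorem IsSlopeScaling.append [FiniteDimensional ℝ F] {M : Submodule ℤ F} {t δ : ℝ} (ht : 0 < t)
    (hδ : 1 ≤ δ) (hM : SlopeGE t M) {k : ℕ} (hk : 1 ≤ k) {b : Fin k → F} (hbM : ∀ i, b i ∈ M)
    (hbi : LinearIndependent ℤ b) (hb : gramDet b ≤ (δ * t) ^ k) {V : Submodule ℝ F}
    (hV : V = Submodule.span ℝ (Set.range b)) (f : OrthonormalBasis (Fin k) ℝ V)
    {m : ℕ} {e : Fin m → F} {s : Fin m → ℝ} {A B : F →ₗ[ℝ] F}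
    (h : IsSlopeScaling (δ ^ (2 * m)) (M.map (orthProj V)) e s A)
    (hB : ∀ x, B x = (√t)⁻¹ • V.starProjection x + A (orthProj V x)) :
    IsSlopeScaling (δ ^ (2 * (k + m))) M (Fin.append (fun i => (f i : F)) e)
      (Fin.append (fun _ => t) s) B := by
  have hVM : V ≤ Submodule.span ℝ (M : Set F) :=
    hV.le.trans (Submodule.span_mono (Set.range_subset_iff.2 hbM))
  have he : ∀ j, e j ∈ Vᗮ := fun j => span_map_orthProj_le_orthogonal M V
    (h.span_eq.le (Submodule.subset_span (Set.mem_range_self j)))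
  have span_f : Submodule.span ℝ (Set.range fun i => (f i : F)) = V := by
    simpa using span_range_coe_basis f.toBasis
  have eigen : ∀ x ∈ M.map (orthProj V), A x ∈ Vᗮ ∧ (A x = 0 → x = 0) := fun x hx =>
    (h.map_mem_span_and_eq_zero (Submodule.subset_span hx)).imp_left
      fun h => span_map_orthProj_le_orthogonal M V h
  constructor
  case orthonormal =>
    exact orthonormal_append (f.orthonormal.comp_linearIsometry V.subtypeₗᵢ) h.orthonormal
      fun i j => Submodule.inner_right_of_mem_orthogonal (f i).2 (he j)
  case span_eq =>
    rw [span_range_append, span_f, h.span_eq, sup_span_map_orthProj hVM]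
  case pos => exact Fin.addCases (by simpa using fun _ => ht) (by simpa using h.pos)
  case map_apply =>
    refine Fin.addCases (fun i => ?_) (fun j => ?_)
    · simp [hB, Submodule.starProjection_orthogonal_val]
    · have proj_e : V.starProjection (e j) = 0 :=
        (Submodule.starProjection_apply_eq_zero_iff V).2 (he j)
      simp [hB, Submodule.starProjection_orthogonal_val, proj_e, h.map_apply]
  case slopeGE_map =>
    exact hM.of_scaling_orthProj ht hB (fun x hx => (eigen x hx).1) (fun x hx => (eigen x hx).2)
      h.slopeGE_map
  case exists_gramDet_le =>
    subst hV
    have : 0 < δ := one_pos.trans_le hδ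
    refine Fin.addCases (fun i => ⟨k, b, i.2, hbM, hbi, hb.trans ?_⟩) (fun j => ?_)
    · rw [Fin.append_left]
      gcongr
      exact le_self_pow₀ hδ (by omega)
    · rw [Fin.append_right]
      have hs := h.pos j
      obtain ⟨d, c, hjd, hc, hci, hct⟩ := h.exists_gramDet_le j
      obtain ⟨c', hc', hc'i, hc't⟩ := hM.exists_gramDet_le_of_map_orthProj ht hδ hbM hbi hb
        (by positivity) (by omega) hc hci hct
      refine ⟨k + d, c', by simpa using hjd, hc', hc'i, hc't.trans ?_⟩
      rw [← mul_assoc, ← pow_add]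
      gcongr
      omega

theorem exists_isSlopeScaling_pow [FiniteDimensional ℝ F] {δ : ℝ} (hδ : 1 < δ) (n : ℕ) :
    ∀ (M : Submodule ℤ F) (c₀ : ℝ), 0 < c₀ → SlopeGE c₀ M →
      Module.finrank ℝ (Submodule.span ℝ (M : Set F)) = n →
      ∃ (e : Fin n → F) (t : Fin n → ℝ) (A : F →ₗ[ℝ] F), IsSlopeScaling (δ ^ (2 * n)) M e t A := by
  induction n using Nat.strong_induction_on with
  | _ n ih =>
  intro M c₀ hc₀ hM hn
  rcases eq_or_ne M ⊥ with rfl | hM0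
  · obtain rfl : n = 0 := by
      rw [← hn, Submodule.bot_coe, Submodule.span_zero_singleton, finrank_bot]
    exact ⟨Fin.elim0, Fin.elim0, 0, .of_span_eq_bot (by simp) _ _ _⟩
  obtain ⟨t, hc₀t, htM, t_max⟩ := hM.exists_maximal hc₀.le hM0
  have ht : 0 < t := hc₀.trans_le hc₀t
  have not_slopeGE := t_max (δ * t) (lt_mul_of_one_lt_left ht hδ)
  simp only [SlopeGE, not_forall, not_le] at not_slopeGE
  obtain ⟨k, b, hbM, hbi, hb⟩ := not_slopeGE
  have hk : 1 ≤ k := Nat.one_le_iff_ne_zero.2 <| by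
    rintro rfl
    simp [gramDet_of_isEmpty] at hb
  set V := Submodule.span ℝ (Set.range b) with hV
  have hVM : V ≤ Submodule.span ℝ (M : Set F) :=
    Submodule.span_mono (Set.range_subset_iff.2 hbM)
  have finrank_V : Module.finrank ℝ V = k := by
    rw [finrank_span_eq_card (htM.linearIndependent ht hbM hbi), Fintype.card_fin]
  obtain ⟨m, hm⟩ : ∃ m, Module.finrank ℝ (Submodule.span ℝ (M.map (orthProj V) : Set F)) = m :=
    ⟨_, rfl⟩
  obtain rfl : n = k + m := by
    rw [← hn, ← finrank_add_finrank_span_map_orthProj hVM, finrank_V, hm]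
  obtain ⟨e, s, A, h⟩ := ih m (by omega) (M.map (orthProj V)) (t / δ ^ k) (by positivity)
    (htM.map_orthProj ht hδ.le hbM hbi hb.le) hm
  exact ⟨_, _, (√t)⁻¹ • (V.starProjection : F →ₗ[ℝ] F) + A ∘ₗ (Vᗮ.starProjection : F →ₗ[ℝ] F),
    .append ht hδ.le htM hk hbM hbi hb.le hV
      ((stdOrthonormalBasis ℝ V).reindex (finCongr finrank_V)) h fun x => rfl⟩

theorem exists_isSlopeScaling [FiniteDimensional ℝ F] {M : Submodule ℤ F} {c₀ θ : ℝ} {n : ℕ}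
    (hc₀ : 0 < c₀) (hM : SlopeGE c₀ M) (hθ : 1 < θ)
    (hn : Module.finrank ℝ (Submodule.span ℝ (M : Set F)) = n) :
    ∃ (e : Fin n → F) (t : Fin n → ℝ) (A : F →ₗ[ℝ] F), IsSlopeScaling θ M e t A := by
  have hδ : 1 < θ ^ (((2 * n + 1 : ℕ) : ℝ)⁻¹) := Real.one_lt_rpow hθ (by positivity)
  have δ_pow : (θ ^ (((2 * n + 1 : ℕ) : ℝ)⁻¹)) ^ (2 * n + 1) = θ :=
    Real.rpow_inv_natCast_pow (by positivity) (by omega)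
  set δ := θ ^ (((2 * n + 1 : ℕ) : ℝ)⁻¹)
  obtain ⟨e, t, A, h⟩ := exists_isSlopeScaling_pow hδ n M c₀ hc₀ hM hn
  refine ⟨e, t, A, { h with exists_gramDet_le := fun j => ?_ }⟩
  obtain ⟨d, c, hjd, hc, hci, hct⟩ := h.exists_gramDet_le j
  have ht := h.pos j
  refine ⟨d, c, hjd, hc, hci, hct.trans ?_⟩
  gcongr
  exact (pow_le_pow_right₀ hδ.le (by omega)).trans_eq δ_pow

end SlopeScaling

section DualFamily

variable {ι : Type*} {b : ι → F}

theorem eq_zero_of_mem_span_of_inner_eq_zero {x : F} (hx : x ∈ Submodule.span ℝ (Set.range b))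
    (h : ∀ i, inner ℝ (b i) x = 0) : x = 0 := by
  have range_le : Submodule.span ℝ (Set.range b) ≤ (ℝ ∙ x)ᗮ := by
    rw [Submodule.span_le]
    rintro _ ⟨i, rfl⟩
    exact Submodule.mem_orthogonal_singleton_iff_inner_left.2 (h i)
  exact inner_self_eq_zero.1 (Submodule.mem_orthogonal_singleton_iff_inner_left.1 (range_le hx))

variable [Fintype ι] [DecidableEq ι]

theorem exists_dual_family (hb : LinearIndependent ℝ b) : ∃ m : ι → F,
    (∀ i j, inner ℝ (m i) (b j) = if i = j then (1 : ℝ) else 0) ∧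
    (∀ i, m i ∈ Submodule.span ℝ (Set.range b)) ∧ gramDet m = (gramDet b)⁻¹ := by
  let G := Matrix.gram ℝ b
  have hG : IsUnit G.det := (gramDet_pos hb).ne'.isUnit
  let m := fun i => ∑ k, G⁻¹ i k • b k
  refine ⟨m, fun i j => ?_, fun i => sum_mem fun k _ =>
    Submodule.smul_mem _ _ (Submodule.subset_span (Set.mem_range_self k)), ?_⟩
  · rw [← Matrix.one_apply, ← Matrix.nonsing_inv_mul G hG]
    simp [m, G, sum_inner, real_inner_smul_left, Matrix.mul_apply, Matrix.gram_apply]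
  · rw [gramDet_of_eq_sum_smul G⁻¹.transpose (c := m) fun j => rfl, Matrix.det_transpose,
      Matrix.det_nonsing_inv, Ring.inverse_eq_inv', pow_two, mul_assoc]
    exact mul_right_eq_self₀.2 (.inl (inv_mul_cancel₀ hG.ne_zero))

theorem eq_sum_inner_smul_of_dual {m : ι → F}
    (h : ∀ i j, inner ℝ (m i) (b j) = if i = j then (1 : ℝ) else 0)
    (hm : ∀ i, m i ∈ Submodule.span ℝ (Set.range b)) {x : F}
    (hx : x ∈ Submodule.span ℝ (Set.range b)) : x = ∑ i, (inner ℝ x (b i) : ℝ) • m i := by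
  rw [← sub_eq_zero]
  refine eq_zero_of_mem_span_of_inner_eq_zero
    (sub_mem hx (sum_mem fun i _ => Submodule.smul_mem _ _ (hm i))) fun j => ?_
  rw [real_inner_comm, inner_sub_left, sum_inner]
  simp [real_inner_smul_left, h]

omit [Fintype ι] in
theorem linearIndependent_of_dual [Finite ι] {m : ι → F}
    (h : ∀ i j, inner ℝ (m i) (b j) = if i = j then (1 : ℝ) else 0) : LinearIndependent ℝ m := by
  cases nonempty_fintype ι
  refine Fintype.linearIndependent_iff.2 fun g hg j => ?_
  simpa [sum_inner, real_inner_smul_left, h] using congrArg (fun x => inner ℝ x (b j)) hg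

end DualFamily

section Lattice

variable {n d : ℕ} {L M : Submodule ℤ (E n)} {l : Fin d → E n}

theorem IsBasisOf.span_real (hl : IsBasisOf l L) :
    Submodule.span ℝ (L : Set (E n)) = Submodule.span ℝ (Set.range l) := by
  rw [← hl.2]
  exact Submodule.span_span_of_tower ℤ ℝ _

theorem IsBasisOf.mem (hl : IsBasisOf l L) (i : Fin d) : l i ∈ L :=
  hl.2.le (Submodule.subset_span (Set.mem_range_self i))

theorem IsBasisOf.mem_dual_iff (hl : IsBasisOf l L) {y : E n} :
    y ∈ dual L ↔ y ∈ Submodule.span ℝ (Set.range l) ∧ ∀ i, ∃ k : ℤ, inner ℝ y (l i) = (k : ℝ) := by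
  rw [← hl.span_real]
  refine ⟨fun h => ⟨h.1, fun i => h.2 _ (hl.mem i)⟩, fun h => ⟨h.1, fun x hx => ?_⟩⟩
  rw [← hl.2, Submodule.mem_span_range_iff_exists_fun] at hx
  obtain ⟨z, rfl⟩ := hx
  choose k hk using h.2
  exact ⟨∑ i, z i * k i, by
    simp [inner_sum, ← Int.cast_smul_eq_zsmul ℝ, real_inner_smul_right, hk]⟩

theorem IsBasisOf.exists_dual (hl : IsBasisOf l L) : ∃ m : Fin d → E n, IsBasisOf m (dual L) ∧
    Submodule.span ℝ (Set.range m) = Submodule.span ℝ (Set.range l) ∧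
    gramDet m = (gramDet l)⁻¹ := by
  obtain ⟨m, hml, hm, gramDet_m⟩ := exists_dual_family hl.1
  have span_m : Submodule.span ℝ (Set.range m) = Submodule.span ℝ (Set.range l) := by
    refine le_antisymm (Submodule.span_le.2 (Set.range_subset_iff.2 hm)) fun x hx => ?_
    rw [eq_sum_inner_smul_of_dual hml hm hx]
    exact sum_mem fun i _ => Submodule.smul_mem _ _ (Submodule.subset_span (Set.mem_range_self i))
  refine ⟨m, ⟨linearIndependent_of_dual hml, le_antisymm ?_ fun y hy => ?_⟩, span_m, gramDet_m⟩
  · rw [Submodule.span_le]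
    rintro _ ⟨i, rfl⟩
    exact hl.mem_dual_iff.2 ⟨hm i, fun j => ⟨if i = j then 1 else 0, by simp [hml]⟩⟩
  · obtain ⟨hy, h_int⟩ := hl.mem_dual_iff.1 hy
    choose k hk using h_int
    rw [eq_sum_inner_smul_of_dual hml hm hy]
    refine sum_mem fun i _ => ?_
    rw [hk, Int.cast_smul_eq_zsmul]
    exact Submodule.smul_mem _ _ (Submodule.subset_span (Set.mem_range_self i))

theorem IsLatticeOfDim.finrank_span (hL : IsLatticeOfDim d L) :
    Module.finrank ℝ (Submodule.span ℝ (L : Set (E n))) = d := by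
  obtain ⟨l, hl⟩ := hL
  rw [hl.span_real, finrank_span_eq_card hl.1, Fintype.card_fin]

theorem IsLattice.isLatticeOfDim (hL : IsLattice L) :
    IsLatticeOfDim (Module.finrank ℝ (Submodule.span ℝ (L : Set (E n)))) L := by
  obtain ⟨d, hL⟩ := hL
  rwa [hL.finrank_span]

theorem IsLatticeOfDim.dual (hL : IsLatticeOfDim d L) : IsLatticeOfDim d (dual L) := by
  obtain ⟨l, hl⟩ := hL
  obtain ⟨m, hm, -⟩ := hl.exists_dual
  exact ⟨m, hm⟩

theorem IsLattice.dual (hL : IsLattice L) : IsLattice (dual L) := hL.imp fun _ h => h.dual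

theorem IsLattice.span_dual (hL : IsLattice L) :
    Submodule.span ℝ (EuclLattice.dual L : Set (E n)) = Submodule.span ℝ (L : Set (E n)) := by
  obtain ⟨d, l, hl⟩ := hL
  obtain ⟨m, hm, span_m, -⟩ := hl.exists_dual
  rw [hm.span_real, span_m, hl.span_real]

theorem IsLattice.exists_slopeGE (hL : IsLattice L) : ∃ c > 0, SlopeGE c L := by
  obtain ⟨d, l, hl⟩ := hL
  obtain ⟨m, hm, span_m, -⟩ := hl.exists_dual
  refine ⟨(∑ k, ‖m k‖ ^ 2 + 1)⁻¹, by positivity, slopeGE_inv_of_inner_int m (fun x hx h => ?_)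
    (fun x hx k => (hm.mem k).2 x hx) (by positivity) (by simp)⟩
  refine eq_zero_of_mem_span_of_inner_eq_zero (b := m) ?_ h
  rw [span_m, ← hl.span_real]
  exact Submodule.subset_span hx

theorem IsLattice.linearIndependent (hL : IsLattice L) {k : ℕ} {c : Fin k → E n}
    (hc : ∀ i, c i ∈ L) (hci : LinearIndependent ℤ c) : LinearIndependent ℝ c := by
  obtain ⟨t, ht, hL⟩ := hL.exists_slopeGE
  exact hL.linearIndependent ht hc hci

theorem IsLattice.fg (hL : IsLattice L) : L.FG := by
  obtain ⟨d, l, -, hl⟩ := hL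
  exact Submodule.fg_def.2 ⟨_, Set.finite_range l, hl⟩

theorem isLattice_of_linearIndependent (hfg : M.FG) (h : ∀ (k : ℕ) (c : Fin k → E n),
    (∀ i, c i ∈ M) → LinearIndependent ℤ c → LinearIndependent ℝ c) : IsLattice M := by
  have : Module.Finite ℤ M := Module.Finite.iff_fg.2 hfg
  have : Module.IsTorsionFree ℤ (E n) := .trans_faithfulSMul ℤ ℝ _
  have : Module.Free ℤ M := Module.free_of_finite_type_torsion_free'
  let B := Module.finBasis ℤ M
  refine ⟨_, fun i => (B i : E n), h _ _ (fun i => (B i).2)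
    (B.linearIndependent.map' M.subtype (Submodule.ker_subtype M)), span_range_coe_basis B⟩

theorem IsLattice.of_le (hL : IsLattice L) (hM : M ≤ L) : IsLattice M := by
  have : IsNoetherian ℤ L := isNoetherian_of_fg_of_noetherian L hL.fg
  exact isLattice_of_linearIndependent (Submodule.FG.of_le hL.fg hM)
    fun k c hc => hL.linearIndependent fun i => hM (hc i)

theorem IsLattice.map_orthProj (hL : IsLattice L) {k : ℕ} {b : Fin k → E n} (hb : ∀ i, b i ∈ L)
    (hbi : LinearIndependent ℤ b) :
    IsLattice (L.map (orthProj (Submodule.span ℝ (Set.range b)))) := by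
  refine isLattice_of_linearIndependent (hL.fg.map _) fun m c hc hci => ?_
  obtain ⟨c', hc'L, hc'i, hc'⟩ := exists_lift_of_map_orthProj hb hbi hc hci
  have := (gramDet_pos (hL.linearIndependent hc'L hc'i)).ne'
  rw [hc'] at this
  exact gramDet_ne_zero_iff.1 (right_ne_zero_of_mul this)

theorem linearIndependent_int_of_real {ι : Type*} {b : ι → F} (hb : LinearIndependent ℝ b) :
    LinearIndependent ℤ b :=
  hb.restrict_scalars fun x y h => by simpa using h

theorem IsLattice.isLatticeOfDim_slice (hM : IsLattice M) {W : Submodule ℝ (E n)}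
    (hW : IsLatticeSubspace M W) : IsLatticeOfDim (Module.finrank ℝ W) (slice M W) := by
  have span_slice : Submodule.span ℝ (slice M W : Set (E n)) = W := by
    refine le_antisymm (Submodule.span_le.2 fun x hx => hx.2) ?_
    obtain ⟨w, hw⟩ := hW
    refine (span_range_coe_basis w).ge.trans (Submodule.span_mono ?_)
    rintro _ ⟨i, rfl⟩
    exact ⟨hw i, (w i).2⟩
  have h : IsLattice (slice M W) := hM.of_le inf_le_left
  have := h.isLatticeOfDim
  rwa [span_slice] at this

theorem isLatticeSubspace_span_range {k : ℕ} {c : Fin k → E n} (hc : ∀ i, c i ∈ M)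
    (hci : LinearIndependent ℝ c) : IsLatticeSubspace M (Submodule.span ℝ (Set.range c)) := by
  have finrank_eq : Module.finrank ℝ (Submodule.span ℝ (Set.range c)) = k := by
    rw [finrank_span_eq_card hci, Fintype.card_fin]
  refine ⟨(Module.Basis.span hci).reindex (finCongr finrank_eq.symm), fun i => ?_⟩
  rw [Module.Basis.reindex_apply]
  exact (congrArg Subtype.val (Module.Basis.span_apply hci _)).symm ▸ hc _

theorem IsLattice.latticeDet_slice_pos_and_le (hM : IsLattice M) {k : ℕ} {c : Fin k → E n}
    (hc : ∀ i, c i ∈ M) (hci : LinearIndependent ℤ c) :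
    0 < latticeDet (slice M (Submodule.span ℝ (Set.range c))) ∧
      latticeDet (slice M (Submodule.span ℝ (Set.range c))) ≤ √(gramDet c) := by
  have hciℝ := hM.linearIndependent hc hci
  have finrank_eq : Module.finrank ℝ (Submodule.span ℝ (Set.range c)) = k := by
    rw [finrank_span_eq_card hciℝ, Fintype.card_fin]
  obtain ⟨u, hu⟩ : IsLatticeOfDim k (slice M (Submodule.span ℝ (Set.range c))) :=
    by simpa only [finrank_eq] using
      hM.isLatticeOfDim_slice (isLatticeSubspace_span_range hc hciℝ)
  rw [latticeDet_eq hu]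
  exact ⟨Real.sqrt_pos.2 (gramDet_pos hu.1), Real.sqrt_le_sqrt <|
    gramDet_le_gramDet_of_mem_span hci fun j => hu.2.ge
      ⟨hc j, Submodule.subset_span (Set.mem_range_self j)⟩⟩

end Lattice

section Suprema

variable {n d : ℕ} {L M : Submodule ℤ (E n)}

theorem mul_rpow_neg_one_div_le_iff {w κ g : ℝ} (hw : 0 ≤ w) (hκ : 0 < κ) (hg : 0 < g)
    (hd : d ≠ 0) : w * √g ^ (-(1 / (d : ℝ))) ≤ κ ↔ ((w / κ) ^ 2) ^ d ≤ g := by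
  have hr : 0 < √g ^ (1 / (d : ℝ)) := by positivity
  have r_pow : ((√g ^ (1 / (d : ℝ))) ^ 2) ^ d = g := by
    rw [← pow_mul, mul_comm, pow_mul, one_div, Real.rpow_inv_natCast_pow (Real.sqrt_nonneg g) hd,
      Real.sq_sqrt hg.le]
  rw [Real.rpow_neg (Real.sqrt_nonneg g), ← div_eq_mul_inv, div_le_comm₀ hr hκ]
  conv_rhs => rw [← r_pow]
  rw [pow_le_pow_iff_left₀ (by positivity) (by positivity) hd,
    pow_le_pow_iff_left₀ (by positivity) hr.le two_ne_zero]

theorem iSup_latticeSubspace_le_iff (hM : IsLattice M) {w : ℕ → ℝ} (hw : ∀ k, 0 ≤ w k) {κ : ℝ}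
    (hκ : 0 < κ) :
    (⨆ (W : Submodule ℝ (E n)) (_ : IsLatticeSubspace M W) (_ : 1 ≤ Module.finrank ℝ W),
      ENNReal.ofReal (w (Module.finrank ℝ W) *
        latticeDet (slice M W) ^ (-(1 / (Module.finrank ℝ W : ℝ))))) ≤ ENNReal.ofReal κ ↔
    ∀ (k : ℕ) (c : Fin k → E n), (∀ i, c i ∈ M) → LinearIndependent ℤ c →
      ((w k / κ) ^ 2) ^ k ≤ gramDet c := by
  simp only [iSup_le_iff, ENNReal.ofReal_le_ofReal_iff hκ.le]
  constructor
  · intro h k c hc hci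
    rcases eq_or_ne k 0 with rfl | hk
    · simp [gramDet_of_isEmpty]
    have hciℝ := hM.linearIndependent hc hci
    have finrank_eq : Module.finrank ℝ (Submodule.span ℝ (Set.range c)) = k := by
      rw [finrank_span_eq_card hciℝ, Fintype.card_fin]
    obtain ⟨det_pos, det_le⟩ := hM.latticeDet_slice_pos_and_le hc hci
    have le_κ := h _ (isLatticeSubspace_span_range hc hciℝ) (by omega)
    rw [finrank_eq] at le_κ
    refine (mul_rpow_neg_one_div_le_iff (hw k) hκ (gramDet_pos hciℝ) hk).1 (le_trans ?_ le_κ)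
    exact mul_le_mul_of_nonneg_left (Real.rpow_le_rpow_of_nonpos det_pos det_le
      (neg_nonpos.2 (by positivity))) (hw k)
  · intro h W hW hW1
    obtain ⟨u, hu⟩ := hM.isLatticeOfDim_slice hW
    rw [latticeDet_eq hu]
    exact (mul_rpow_neg_one_div_le_iff (hw _) hκ (gramDet_pos hu.1) (by omega)).2
      (h _ u (fun i => (hu.mem i).1) (linearIndependent_int_of_real hu.1))

theorem etaDet_le_ofReal_iff (hL : IsLattice L) {η : ℝ} (hη : 0 < η) :
    etaDet L ≤ ENNReal.ofReal η ↔ SlopeGE (η ^ 2)⁻¹ (dual L) := by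
  simpa [SlopeGE, etaDet] using
    iSup_latticeSubspace_le_iff hL.dual (w := 1) (fun _ => zero_le_one) hη

theorem klBound_le_ofReal_iff (hL : IsLattice L) {κ : ℝ} (hκ : 0 < κ) :
    klBound L ≤ ENNReal.ofReal κ ↔ ∀ (k : ℕ) (c : Fin k → E n), (∀ i, c i ∈ dual L) →
      LinearIndependent ℤ c → (k / κ ^ 2) ^ k ≤ gramDet c := by
  simpa only [klBound, div_pow, Real.sq_sqrt (Nat.cast_nonneg _)] using
    iSup_latticeSubspace_le_iff hL.dual (w := fun k => √k) (fun _ => Real.sqrt_nonneg _) hκ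

theorem latticeDet_nonneg (L : Submodule ℤ (E n)) : 0 ≤ latticeDet L := by
  rw [latticeDet]
  split_ifs
  exacts [Real.sqrt_nonneg _, le_rfl]

theorem etaDet_le_klBound (L : Submodule ℤ (E n)) : etaDet L ≤ klBound L := by
  refine iSup_mono fun W => iSup₂_mono fun _ hW1 => ENNReal.ofReal_le_ofReal ?_
  refine le_mul_of_one_le_left (Real.rpow_nonneg (latticeDet_nonneg _) _) ?_
  exact Real.one_le_sqrt.2 (by exact_mod_cast hW1)

theorem klBound_le_sqrt_mul_etaDet (L : Submodule ℤ (E n)) :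
    klBound L ≤ ENNReal.ofReal √n * etaDet L := by
  refine iSup_le fun W => iSup₂_le fun hW hW1 => ?_
  rw [ENNReal.ofReal_mul (Real.sqrt_nonneg _)]
  gcongr
  · exact_mod_cast (Submodule.finrank_le W).trans_eq (by simp)
  · exact le_iSup_of_le W (le_iSup₂_of_le hW hW1 le_rfl)

theorem IsLattice.etaDet_ne_top (hL : IsLattice L) : etaDet L ≠ ⊤ := by
  obtain ⟨c, hc, h⟩ := hL.dual.exists_slopeGE
  refine ne_top_of_le_ne_top (ENNReal.ofReal_ne_top (r := (√c)⁻¹)) ?_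
  rw [etaDet_le_ofReal_iff hL (by positivity), inv_pow, inv_inv, Real.sq_sqrt hc.le]
  exact h

theorem IsLattice.klBound_ne_top (hL : IsLattice L) : klBound L ≠ ⊤ :=
  ne_top_of_le_ne_top (ENNReal.mul_ne_top ENNReal.ofReal_ne_top hL.etaDet_ne_top)
    (klBound_le_sqrt_mul_etaDet L)

theorem IsLatticeOfDim.etaDet_ne_zero (hL : IsLatticeOfDim d L) (hd : d ≠ 0) : etaDet L ≠ 0 := by
  obtain ⟨m, hm⟩ := hL.dual
  let i : Fin d := ⟨0, Nat.pos_of_ne_zero hd⟩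
  have hmi : 0 < ‖m i‖ := norm_pos_iff.2 (hm.1.ne_zero i)
  intro h
  have hη : 0 < (2 * ‖m i‖)⁻¹ := by positivity
  have slope := (etaDet_le_ofReal_iff ⟨d, hL⟩ hη).1 (h.le.trans zero_le)
  have := slope.le_norm_sq (hm.mem i) (hm.1.ne_zero i)
  rw [inv_pow, inv_inv] at this
  nlinarith

theorem IsLatticeOfDim.klBound_ne_zero (hL : IsLatticeOfDim d L) (hd : d ≠ 0) : klBound L ≠ 0 :=
  (pos_of_ne_zero (hL.etaDet_ne_zero hd)).trans_le (etaDet_le_klBound L) |>.ne'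

end Suprema

section MatrixImage

variable {n d : ℕ} {L : Submodule ℤ (E n)} {R : Matrix (Fin n) (Fin n) ℝ}

theorem inner_toEuclideanLin_transpose (R : Matrix (Fin n) (Fin n) ℝ) (x y : E n) :
    inner ℝ (Matrix.toEuclideanLin R.transpose x) y = inner ℝ x (Matrix.toEuclideanLin R y) := by
  rw [← Matrix.conjTranspose_eq_transpose_of_trivial,
    Matrix.toEuclideanLin_conjTranspose_eq_adjoint, LinearMap.adjoint_inner_left]

theorem toEuclideanLin_injective (hR : R.det ≠ 0) :
    Function.Injective (Matrix.toEuclideanLin R) := fun _ _ h =>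
  WithLp.ofLp_injective 2 <| Matrix.mulVec_injective_of_isUnit
    ((Matrix.isUnit_iff_isUnit_det R).2 hR.isUnit) (congrArg WithLp.ofLp h)

theorem sum_norm_sq_toEuclideanLin (R : Matrix (Fin n) (Fin n) ℝ) :
    ∑ k, ‖Matrix.toEuclideanLin R (EuclideanSpace.basisFun (Fin n) ℝ k)‖ ^ 2 =
      (R.transpose * R).trace := by
  simp [EuclideanSpace.norm_sq_eq, Matrix.trace, Matrix.mul_apply, Matrix.toLpLin_apply, ← sq]

theorem trace_transpose_mul_self_pos (hn : n ≠ 0) (hR : R.det ≠ 0) :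
    0 < (R.transpose * R).trace := by
  have : NeZero n := ⟨hn⟩
  rw [← sum_norm_sq_toEuclideanLin]
  refine Finset.sum_pos (fun k _ => pow_pos (norm_pos_iff.2 ?_) 2) Finset.univ_nonempty
  rw [map_ne_zero_iff _ (toEuclideanLin_injective hR)]
  exact (EuclideanSpace.basisFun (Fin n) ℝ).orthonormal.ne_zero k

theorem gramDet_toEuclideanLin_transpose_le (R : Matrix (Fin n) (Fin n) ℝ) (c : Fin d → E n) :
    gramDet (fun i => Matrix.toEuclideanLin R.transpose (c i)) ≤
      ((R.transpose * R).trace / d) ^ d * gramDet c := by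
  have norm_sq : ∀ x, ‖Matrix.toEuclideanLin R.transpose x‖ ^ 2 =
      ∑ k, inner ℝ (Matrix.toEuclideanLin R (EuclideanSpace.basisFun (Fin n) ℝ k)) x ^ 2 := by
    intro x
    simp_rw [real_inner_comm x, ← inner_toEuclideanLin_transpose,
      real_inner_comm (EuclideanSpace.basisFun (Fin n) ℝ _)]
    simpa using ((EuclideanSpace.basisFun (Fin n) ℝ).sum_sq_norm_inner_right
      (Matrix.toEuclideanLin R.transpose x)).symm
  simpa only [sum_norm_sq_toEuclideanLin, Fintype.card_fin] using
    gramDet_map_le_of_norm_sq_le_sum_inner_sq _ (fun x => (norm_sq x).le) c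

theorem IsLatticeOfDim.matImage (hL : IsLatticeOfDim d L) (hR : R.det ≠ 0) :
    IsLatticeOfDim d (matImage R L) := by
  obtain ⟨l, hli, hl⟩ := hL
  refine ⟨_, hli.map' _ (LinearMap.ker_eq_bot.2 (toEuclideanLin_injective hR)), ?_⟩
  rw [EuclLattice.matImage, ← hl, Submodule.map_span, ← Set.range_comp]
  rfl

theorem IsLatticeOfDim.span_eq_top (hL : IsLatticeOfDim n L) :
    Submodule.span ℝ (L : Set (E n)) = ⊤ :=
  Submodule.eq_top_of_finrank_eq (by rw [hL.finrank_span, finrank_euclideanSpace_fin])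

theorem IsLatticeOfDim.transpose_mem_dual (hL : IsLatticeOfDim n L) {y : E n}
    (hy : y ∈ EuclLattice.dual (EuclLattice.matImage R L)) :
    Matrix.toEuclideanLin R.transpose y ∈ EuclLattice.dual L := by
  refine ⟨by rw [hL.span_eq_top]; trivial, fun x hx => ?_⟩
  rw [inner_toEuclideanLin_transpose]
  exact hy.2 _ (Submodule.mem_map_of_mem hx)

theorem exists_pos_ofReal_eq {a : ℝ≥0∞} (h0 : a ≠ 0) (htop : a ≠ ⊤) :
    ∃ x : ℝ, 0 < x ∧ ENNReal.ofReal x = a :=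
  ⟨a.toReal, ENNReal.toReal_pos h0 htop, ENNReal.ofReal_toReal htop⟩

theorem klBound_matImage_le (hL : IsLatticeOfDim n L) (hR : R.det ≠ 0) :
    klBound (matImage R L) ≤ ENNReal.ofReal √(R.transpose * R).trace * etaDet L := by
  rcases eq_or_ne n 0 with rfl | hn
  · simpa using klBound_le_sqrt_mul_etaDet (matImage R L)
  have tr_pos := trace_transpose_mul_self_pos hn hR
  obtain ⟨η, hη, η_eq⟩ := exists_pos_ofReal_eq (hL.etaDet_ne_zero hn)
    (IsLattice.etaDet_ne_top ⟨n, hL⟩)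
  have slope := (etaDet_le_ofReal_iff ⟨n, hL⟩ hη).1 η_eq.ge
  rw [← η_eq, ← ENNReal.ofReal_mul (Real.sqrt_nonneg _),
    klBound_le_ofReal_iff ⟨n, hL.matImage hR⟩ (by positivity)]
  intro k c hc hci
  rcases eq_or_ne k 0 with rfl | hk
  · simp [gramDet_of_isEmpty]
  have image_indep : LinearIndependent ℤ fun i => Matrix.toEuclideanLin R.transpose (c i) :=
    hci.map' ((Matrix.toEuclideanLin R.transpose).restrictScalars ℤ)
      (LinearMap.ker_eq_bot.2 (toEuclideanLin_injective (by rwa [Matrix.det_transpose])))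
  have le_image := slope k _ (fun i => hL.transpose_mem_dual (hc i)) image_indep
  have image_le := gramDet_toEuclideanLin_transpose_le R c
  calc (k / (√(R.transpose * R).trace * η) ^ 2) ^ k
      = (k / (R.transpose * R).trace) ^ k * ((η ^ 2)⁻¹) ^ k := by
        rw [mul_pow, Real.sq_sqrt tr_pos.le, ← mul_pow, ← div_eq_mul_inv, div_div]
    _ ≤ (k / (R.transpose * R).trace) ^ k * (((R.transpose * R).trace / k) ^ k * gramDet c) := by
        gcongr
        exact le_image.trans image_le
    _ = gramDet c := by
        rw [← mul_assoc, ← mul_pow, div_mul_div_cancel₀ tr_pos.ne', div_self (by exact_mod_cast hk),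
          one_pow, one_mul]

theorem etaMuCirc_le_mul_etaDet (hL : IsLatticeOfDim n L) {C : ℝ≥0∞}
    (hC : ∀ L : Submodule ℤ (E n), IsLattice L → coveringRadius L ≤ C * klBound L) :
    etaMuCirc L ≤ C * etaDet L := by
  refine iSup₂_le fun R hR => ENNReal.div_le_of_le_mul ?_
  calc coveringRadius (matImage R L) ≤ C * klBound (matImage R L) := hC _ ⟨n, hL.matImage hR⟩
    _ ≤ C * (ENNReal.ofReal √(R.transpose * R).trace * etaDet L) := by
      gcongr
      exact klBound_matImage_le hL hR
    _ = C * etaDet L * ENNReal.ofReal √(R.transpose * R).trace := by ring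

end MatrixImage

section Constants

variable {n : ℕ} {L : Submodule ℤ (E n)}

theorem isLeast_sInf_le_mul {α : Type*} {p : α → Prop} {f g : α → ℝ≥0∞} (hg : ∀ a, p a → g a ≠ ⊤)
    (h0 : ∀ a, p a → g a = 0 → f a = 0) :
    IsLeast {C : ℝ≥0∞ | ∀ a, p a → f a ≤ C * g a} (sInf {C : ℝ≥0∞ | ∀ a, p a → f a ≤ C * g a}) := by
  refine ⟨fun a ha => ?_, fun C hC => sInf_le hC⟩
  by_cases h : g a = 0
  · exact (h0 a ha h).trans_le zero_le
  · rw [← ENNReal.div_le_iff_le_mul (.inl h) (.inl (hg a ha))]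
    exact le_sInf fun C hC => (ENNReal.div_le_iff_le_mul (.inl h) (.inl (hg a ha))).2 (hC a ha)

theorem coveringRadius_le_ofReal {r : ℝ} (hr : 0 ≤ r)
    (h : ∀ x ∈ Submodule.span ℝ (L : Set (E n)), ∃ y ∈ L, ‖x - y‖ ≤ r) :
    coveringRadius L ≤ ENNReal.ofReal r :=
  iInf₂_le r.toNNReal (by simpa only [Real.coe_toNNReal r hr] using h)

theorem IsLatticeOfDim.coveringRadius_eq_zero (hL : IsLatticeOfDim 0 L) : coveringRadius L = 0 := by
  refine le_antisymm ((coveringRadius_le_ofReal le_rfl fun x hx => ⟨0, zero_mem _, ?_⟩).trans_eq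
    ENNReal.ofReal_zero) zero_le
  rw [Submodule.finrank_eq_zero.1 hL.finrank_span, Submodule.mem_bot] at hx
  simp [hx]

theorem isLeast_detConst (hn : n ≠ 0) :
    IsLeast {C : ℝ≥0∞ | ∀ L : Submodule ℤ (E n), IsLatticeOfDim n L →
      etaMuCirc L ≤ C * etaDet L} (detConst n) :=
  isLeast_sInf_le_mul (fun _ hL => IsLattice.etaDet_ne_top ⟨n, hL⟩)
    (fun _ hL h => absurd h (hL.etaDet_ne_zero hn))

theorem isLeast_klConst (n : ℕ) :
    IsLeast {C : ℝ≥0∞ | ∀ L : Submodule ℤ (E n), IsLattice L →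
      coveringRadius L ≤ C * klBound L} (klConst n) := by
  refine isLeast_sInf_le_mul (fun _ hL => hL.klBound_ne_top) ?_
  rintro L ⟨d, hL⟩ h
  obtain rfl : d = 0 := of_not_not fun hd => hL.klBound_ne_zero hd h
  exact hL.coveringRadius_eq_zero

theorem detConst_le_klConst (n : ℕ) : detConst n ≤ klConst n :=
  sInf_le fun _ hL => etaMuCirc_le_mul_etaDet hL (isLeast_klConst n).1

end Constants

section Transference

theorem exists_ne_zero_mem_span_abs_le {ι : Type*} [Fintype ι] [DecidableEq ι] [Nonempty ι]
    (b : Module.Basis ι ℝ (ι → ℝ)) {a : ℝ} (ha : 0 ≤ a)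
    (h : |(Matrix.of b).det| ≤ a ^ Fintype.card ι) :
    ∃ x ∈ Submodule.span ℤ (Set.range b), x ≠ 0 ∧ ∀ i, |x i| ≤ a := by
  have volume_le : MeasureTheory.volume (ZSpan.fundamentalDomain b) *
      2 ^ Module.finrank ℝ (ι → ℝ) ≤ MeasureTheory.volume (Metric.closedBall (0 : ι → ℝ) a) := by
    rw [ZSpan.volume_fundamentalDomain, Real.volume_pi_closedBall _ ha,
      Module.finrank_fintype_fun_eq_card, ← ENNReal.ofReal_ofNat 2,
      ← ENNReal.ofReal_pow zero_le_two, ← ENNReal.ofReal_mul (abs_nonneg _), mul_pow, mul_comm]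
    gcongr
  have : Countable (Submodule.span ℤ (Set.range b)).toAddSubgroup :=
    inferInstanceAs (Countable (Submodule.span ℤ (Set.range b)))
  obtain ⟨x, hx0, hx⟩ :=
    MeasureTheory.exists_ne_zero_mem_lattice_of_measure_mul_two_pow_le_measure
      (ZSpan.isAddFundamentalDomain' b MeasureTheory.volume) (s := Metric.closedBall 0 a)
      (fun x hx => by simpa using hx) (convex_closedBall _ _) (isCompact_closedBall _ _) volume_le
  rw [mem_closedBall_zero_iff, pi_norm_le_iff_of_nonneg ha] at hx
  exact ⟨x, x.2, by simpa using hx0, hx⟩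

theorem exists_ne_zero_mem_span_norm_sq_le {ι : Type*} [Fintype ι] [DecidableEq ι] [Nonempty ι]
    {b : ι → F} (hb : LinearIndependent ℝ b) {a : ℝ} (ha : 0 ≤ a)
    (h : gramDet b ≤ a ^ Fintype.card ι) :
    ∃ v ∈ Submodule.span ℤ (Set.range b), v ≠ 0 ∧ ‖v‖ ^ 2 ≤ Fintype.card ι * a := by
  obtain ⟨f, P, hf, hP⟩ := exists_orthonormal_eq_sum_smul hb
  let T : (ι → ℝ) →ₗ[ℝ] F := Fintype.linearCombination ℝ f
  let rows : ι → ι → ℝ := fun j i => P i j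
  have hT : T ∘ rows = b := funext fun j => (hP j).symm
  have gramDet_eq : gramDet b = P.det ^ 2 := by
    rw [gramDet_of_eq_sum_smul P hP, gramDet_of_orthonormal hf, mul_one]
  let B := basisOfLinearIndependentOfCardEqFinrank (LinearIndependent.of_comp T (hT ▸ hb)) (by simp)
  have B_eq : ⇑B = rows := coe_basisOfLinearIndependentOfCardEqFinrank _ _
  have abs_det_le : |(Matrix.of B).det| ≤ √a ^ Fintype.card ι := by
    refine abs_le_of_sq_le_sq ?_ (by positivity)
    rw [B_eq, show Matrix.of rows = P.transpose from rfl, Matrix.det_transpose, ← gramDet_eq,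
      ← pow_mul, mul_comm, pow_mul, Real.sq_sqrt ha]
    exact h
  obtain ⟨x, hx, hx0, hxa⟩ := exists_ne_zero_mem_span_abs_le B (Real.sqrt_nonneg a) abs_det_le
  refine ⟨T x, ?_, ?_, ?_⟩
  · have := Submodule.mem_map_of_mem (f := T.restrictScalars ℤ) hx
    rwa [Submodule.map_span, B_eq, ← Set.range_comp, LinearMap.coe_restrictScalars, hT] at this
  · exact (map_ne_zero_iff T hf.linearIndependent.fintypeLinearCombination_injective).2 hx0
  · calc ‖T x‖ ^ 2 = ∑ i, x i ^ 2 := by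
          rw [← real_inner_self_eq_norm_sq, Fintype.linearCombination_apply, hf.inner_sum]
          simp [sq]
      _ ≤ ∑ _ : ι, a := Finset.sum_le_sum fun i _ => by
          rw [← sq_abs]
          exact (pow_le_pow_left₀ (abs_nonneg _) (hxa i) 2).trans_eq (Real.sq_sqrt ha)
      _ = Fintype.card ι * a := by simp

theorem norm_sub_round_zsmul_sq_le [FiniteDimensional ℝ F] (w u : F) :
    ‖u - round (inner ℝ w u / ‖w‖ ^ 2 : ℝ) • w‖ ^ 2 ≤
      ‖w‖ ^ 2 / 4 + ‖orthProj (Submodule.span ℝ {w}) u‖ ^ 2 := by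
  set q : ℝ := inner ℝ w u / ‖w‖ ^ 2 with hq
  have split : u - round q • w = (q - round q) • w + orthProj (Submodule.span ℝ {w}) u := by
    rw [orthProj_apply, Submodule.starProjection_orthogonal_val, Submodule.starProjection_singleton,
      sub_smul, Int.cast_smul_eq_zsmul]
    simp only [RCLike.ofReal_real_eq_id, id_eq, ← hq]
    abel
  have orthogonal : inner ℝ ((q - round q) • w) (orthProj (Submodule.span ℝ {w}) u) = 0 := by
    rw [orthProj_apply]
    exact Submodule.inner_right_of_mem_orthogonal
      (Submodule.smul_mem _ _ (Submodule.mem_span_singleton_self w))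
      (Submodule.starProjection_apply_mem _ u)
  have sq_le : (q - round q) ^ 2 ≤ 1 / 4 := by
    have := sq_le_sq' (neg_le_of_abs_le (abs_sub_round q)) (le_of_abs_le (abs_sub_round q))
    norm_num at this ⊢
    exact this
  rw [split, sq, norm_add_sq_eq_norm_sq_add_norm_sq_real orthogonal, ← sq, ← sq, norm_smul,
    mul_pow, Real.norm_eq_abs, sq_abs]
  nlinarith [sq_nonneg ‖w‖]

variable {n : ℕ} {L : Submodule ℤ (E n)}

theorem exists_ne_zero_mem_norm_sq_le_of_slopeGE_dual {d : ℕ} (hL : IsLatticeOfDim d L)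
    (hd : d ≠ 0) {s : ℝ} (hs : 0 < s) (hdual : SlopeGE s (dual L)) :
    ∃ v ∈ L, v ≠ 0 ∧ ‖v‖ ^ 2 ≤ d / s := by
  obtain ⟨l, hl⟩ := hL
  obtain ⟨m, hm, -, gramDet_m⟩ := hl.exists_dual
  have : NeZero d := ⟨hd⟩
  have gramDet_l_le : gramDet l ≤ s⁻¹ ^ d := by
    have := hdual d m hm.mem (linearIndependent_int_of_real hm.1)
    rw [gramDet_m] at this
    rw [inv_pow]
    exact (le_inv_comm₀ (by positivity) (gramDet_pos hl.1)).1 this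
  simpa only [hl.2, Fintype.card_fin, ← div_eq_mul_inv] using
    exists_ne_zero_mem_span_norm_sq_le hl.1 (inv_nonneg.2 hs.le) (by simpa using gramDet_l_le)

theorem dual_map_orthProj_le {V : Submodule ℝ (E n)} (hV : V ≤ Submodule.span ℝ (L : Set (E n))) :
    dual (L.map (orthProj V)) ≤ dual L := by
  rintro y ⟨hy, hy_int⟩
  refine ⟨sup_span_map_orthProj hV ▸ Submodule.mem_sup_right hy, fun x hx => ?_⟩
  obtain ⟨k, hk⟩ := hy_int _ (Submodule.mem_map_of_mem hx)
  refine ⟨k, hk ▸ ?_⟩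
  have hyV := span_map_orthProj_le_orthogonal L V hy
  rw [orthProj_apply, ← Submodule.inner_starProjection_left_eq_right,
    Submodule.starProjection_eq_self_iff.2 hyV]

theorem orthProj_mem_span_map {M : Submodule ℤ (E n)} (V : Submodule ℝ (E n)) {x : E n}
    (hx : x ∈ Submodule.span ℝ (M : Set (E n))) :
    orthProj V x ∈ Submodule.span ℝ (M.map (orthProj V) : Set (E n)) := by
  have := Submodule.mem_map_of_mem (f := (Vᗮ.starProjection : E n →ₗ[ℝ] E n)) hx
  rwa [Submodule.map_span] at this

theorem IsLatticeOfDim.map_orthProj_span_singleton {d : ℕ} (hL : IsLatticeOfDim (d + 1) L) {v : E n}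
    (hv : v ∈ L) (hv0 : v ≠ 0) : IsLatticeOfDim d (L.map (orthProj (Submodule.span ℝ {v}))) := by
  have : Module.IsTorsionFree ℤ (E n) := .trans_faithfulSMul ℤ ℝ _
  have proj_lattice : IsLattice (L.map (orthProj (Submodule.span ℝ {v}))) := by
    simpa using IsLattice.map_orthProj ⟨_, hL⟩ (b := fun _ : Fin 1 => v) (fun _ => hv)
      (LinearIndependent.of_subsingleton 0 hv0)
  have finrank_proj := finrank_add_finrank_span_map_orthProj
    (Submodule.span_mono (Set.singleton_subset_iff.2 hv) :
      Submodule.span ℝ {v} ≤ Submodule.span ℝ (L : Set (E n)))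
  rw [hL.finrank_span, finrank_span_singleton hv0, add_comm, Nat.succ_inj] at finrank_proj
  exact finrank_proj ▸ proj_lattice.isLatticeOfDim

theorem exists_mem_norm_sub_sq_le_of_slopeGE_dual {s : ℝ} (hs : 0 < s) {d : ℕ} :
    ∀ {L : Submodule ℤ (E n)}, IsLatticeOfDim d L → SlopeGE s (dual L) →
      ∀ x ∈ Submodule.span ℝ (L : Set (E n)), ∃ y ∈ L, ‖x - y‖ ^ 2 ≤ d ^ 2 / s := by
  induction d with
  | zero =>
    intro L hL _ x hx
    rw [Submodule.finrank_eq_zero.1 hL.finrank_span, Submodule.mem_bot] at hx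
    exact ⟨0, zero_mem L, by simp [hx]⟩
  | succ d ih =>
    intro L hL hdual x hx
    obtain ⟨v, hvL, hv0, hv⟩ :=
      exists_ne_zero_mem_norm_sq_le_of_slopeGE_dual hL d.succ_ne_zero hs hdual
    have hvL' : Submodule.span ℝ {v} ≤ Submodule.span ℝ (L : Set (E n)) :=
      Submodule.span_mono (Set.singleton_subset_iff.2 hvL)
    obtain ⟨_, ⟨y, hy, rfl⟩, hxy⟩ := ih (hL.map_orthProj_span_singleton hvL hv0)
      (hdual.mono (dual_map_orthProj_le hvL')) _ (orthProj_mem_span_map _ hx)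
    refine ⟨y + round (inner ℝ v (x - y) / ‖v‖ ^ 2 : ℝ) • v, add_mem hy (zsmul_mem hvL _), ?_⟩
    rw [← sub_sub]
    rw [← map_sub] at hxy
    calc _ ≤ ‖v‖ ^ 2 / 4 + ‖orthProj (Submodule.span ℝ {v}) (x - y)‖ ^ 2 :=
        norm_sub_round_zsmul_sq_le _ _
      _ ≤ ((d + 1 : ℕ) / s) / 4 + d ^ 2 / s := by gcongr
      _ = ((d + 1 : ℕ) / 4 + d ^ 2) / s := by ring
      _ ≤ (d + 1 : ℕ) ^ 2 / s := by
        gcongr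
        push_cast
        linarith [sq_nonneg (d : ℝ), add_sq (d : ℝ) 1, (Nat.cast_nonneg d : (0 : ℝ) ≤ d)]

theorem IsLattice.coveringRadius_le_mul_etaDet (hL : IsLattice L) :
    coveringRadius L ≤ n * etaDet L := by
  obtain ⟨d, hLd⟩ := id hL
  rcases eq_or_ne d 0 with rfl | hd
  · exact hLd.coveringRadius_eq_zero.trans_le zero_le
  obtain ⟨η, hη, η_eq⟩ := exists_pos_ofReal_eq (hLd.etaDet_ne_zero hd) (IsLattice.etaDet_ne_top hL)
  have slope := (etaDet_le_ofReal_iff hL hη).1 η_eq.ge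
  have hdn : d ≤ n :=
    hLd.finrank_span ▸ (Submodule.finrank_le _).trans_eq finrank_euclideanSpace_fin
  rw [← η_eq, ← ENNReal.ofReal_natCast, ← ENNReal.ofReal_mul (by positivity)]
  refine coveringRadius_le_ofReal (by positivity) fun x hx => ?_
  obtain ⟨y, hy, hxy⟩ := exists_mem_norm_sub_sq_le_of_slopeGE_dual (by positivity) hLd slope x hx
  refine ⟨y, hy, le_of_sq_le_sq (hxy.trans ?_) (by positivity)⟩
  rw [div_inv_eq_mul, mul_pow]
  gcongr

theorem klConst_le (n : ℕ) : klConst n ≤ n := sInf_le fun L hL =>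
  hL.coveringRadius_le_mul_etaDet.trans (by gcongr; exact etaDet_le_klBound L)

end Transference

section FullRank

variable {n d : ℕ} {L N : Submodule ℤ (E n)} {R : Matrix (Fin n) (Fin n) ℝ}

theorem matImage_matImage (R S : Matrix (Fin n) (Fin n) ℝ) (L : Submodule ℤ (E n)) :
    matImage R (matImage S L) = matImage (R * S) L := by
  ext x
  simp [matImage, Matrix.toLpLin_apply]

theorem IsLatticeOfDim.dual_matImage_le (hL : IsLatticeOfDim n L) (hR : R.det ≠ 0) :
    EuclLattice.dual (EuclLattice.matImage R.transpose⁻¹ L) ≤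
      EuclLattice.matImage R (EuclLattice.dual L) := by
  intro y hy
  refine ⟨_, hL.transpose_mem_dual hy, ?_⟩
  have : R * R⁻¹ = 1 := Matrix.mul_nonsing_inv R hR.isUnit
  simp [← Matrix.transpose_nonsing_inv, Matrix.toLpLin_apply, this]

theorem IsLatticeOfDim.coveringRadius_matImage_le (hn : n ≠ 0) (hL : IsLatticeOfDim n L)
    (hR : R.det ≠ 0) :
    coveringRadius (EuclLattice.matImage R L) ≤
      detConst n * etaDet L * ENNReal.ofReal √(R.transpose * R).trace := by
  rw [← ENNReal.div_le_iff (ENNReal.ofReal_pos.2 (Real.sqrt_pos.2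
    (trace_transpose_mul_self_pos hn hR))).ne' ENNReal.ofReal_ne_top]
  exact (le_iSup₂ (f := fun (R : Matrix (Fin n) (Fin n) ℝ) (_ : R.det ≠ 0) =>
    coveringRadius (EuclLattice.matImage R L) / ENNReal.ofReal √(R.transpose * R).trace) R hR).trans
    ((isLeast_detConst hn).1 L hL)

theorem IsLatticeOfDim.coveringRadius_le_of_slopeGE_matImage_dual (hn : n ≠ 0)
    (hL : IsLatticeOfDim n L) (hR : R.det ≠ 0)
    (h : SlopeGE 1 (EuclLattice.matImage R (EuclLattice.dual L))) :
    coveringRadius L ≤ detConst n * ENNReal.ofReal √(R.transpose * R).trace := by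
  have det_transpose : R.transpose.det ≠ 0 := by rwa [Matrix.det_transpose]
  have hL' : IsLatticeOfDim n (EuclLattice.matImage R.transpose⁻¹ L) :=
    hL.matImage (Matrix.isUnit_nonsing_inv_det _ det_transpose.isUnit).ne_zero
  have etaDet_le : etaDet (EuclLattice.matImage R.transpose⁻¹ L) ≤ 1 := by
    rw [← ENNReal.ofReal_one, etaDet_le_ofReal_iff ⟨n, hL'⟩ one_pos]
    simpa using h.mono (hL.dual_matImage_le hR)
  have matImage_eq :
      EuclLattice.matImage R.transpose (EuclLattice.matImage R.transpose⁻¹ L) = L := by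
    rw [matImage_matImage, Matrix.mul_nonsing_inv _ det_transpose.isUnit]
    simp [EuclLattice.matImage]
  have le := hL'.coveringRadius_matImage_le hn det_transpose
  rw [matImage_eq, Matrix.transpose_transpose, Matrix.trace_mul_comm] at le
  refine le.trans ?_
  gcongr
  exact mul_le_of_le_one_right' etaDet_le

theorem sum_norm_sq_map_orthonormalBasis_eq {V W ι κ : Type*} [NormedAddCommGroup V]
    [InnerProductSpace ℝ V] [NormedAddCommGroup W] [InnerProductSpace ℝ W] [FiniteDimensional ℝ V]
    [FiniteDimensional ℝ W] [Fintype ι] [Fintype κ] (A : V →ₗ[ℝ] W) (g : OrthonormalBasis ι ℝ V)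
    (g' : OrthonormalBasis κ ℝ V) : ∑ i, ‖A (g i)‖ ^ 2 = ∑ i, ‖A (g' i)‖ ^ 2 := by
  have trace_eq := (LinearMap.trace_eq_sum_inner (A.adjoint ∘ₗ A) g).symm.trans
    (LinearMap.trace_eq_sum_inner (A.adjoint ∘ₗ A) g')
  simpa only [LinearMap.comp_apply, LinearMap.adjoint_inner_right, real_inner_self_eq_norm_sq]
    using trace_eq

theorem IsLatticeOfDim.coveringRadius_le_of_slopeGE_map_dual {ι : Type*} [Fintype ι] (hn : n ≠ 0)
    (hL : IsLatticeOfDim n L) {A : E n →ₗ[ℝ] E n} (hA : Function.Injective A)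
    (h : SlopeGE 1 ((EuclLattice.dual L).map (A.restrictScalars ℤ)))
    (g : OrthonormalBasis ι ℝ (E n)) :
    coveringRadius L ≤ detConst n * ENNReal.ofReal √(∑ i, ‖A (g i)‖ ^ 2) := by
  obtain ⟨R, rfl⟩ := Matrix.toEuclideanLin.surjective A
  rw [sum_norm_sq_map_orthonormalBasis_eq _ g (EuclideanSpace.basisFun (Fin n) ℝ),
    sum_norm_sq_toEuclideanLin]
  refine hL.coveringRadius_le_of_slopeGE_matImage_dual hn (fun hR => ?_) h
  obtain ⟨v, hv, hRv⟩ := Matrix.exists_mulVec_eq_zero_iff.2 hR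
  have map_v : Matrix.toEuclideanLin R (WithLp.toLp 2 v) = 0 := by simp [Matrix.toLpLin_toLp, hRv]
  exact hv (congrArg WithLp.ofLp ((map_eq_zero_iff _ hA).1 map_v))

theorem IsLatticeOfDim.sup {k : ℕ} (hL : IsLatticeOfDim d L) (hN : IsLatticeOfDim k N)
    (h : Disjoint (Submodule.span ℝ (L : Set (E n))) (Submodule.span ℝ (N : Set (E n)))) :
    IsLatticeOfDim (d + k) (L ⊔ N) := by
  obtain ⟨l, hl⟩ := hL
  obtain ⟨m, hm⟩ := hN
  rw [hl.span_real, hm.span_real] at h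
  refine ⟨Sum.elim l m ∘ finSumFinEquiv.symm,
    (hl.1.sum_type hm.1 h).comp _ finSumFinEquiv.symm.injective, ?_⟩
  rw [finSumFinEquiv.symm.surjective.range_comp, Set.Sum.elim_range, Submodule.span_union, hl.2,
    hm.2]

theorem coveringRadius_le_coveringRadius_sup
    (hN : N ≤ (Submodule.span ℝ (L : Set (E n)))ᗮ.restrictScalars ℤ) :
    coveringRadius L ≤ coveringRadius (L ⊔ N) := by
  refine le_iInf₂ fun r hr => iInf₂_le r fun x hx => ?_
  obtain ⟨_, hy, hxy⟩ := hr x (Submodule.span_mono (by exact_mod_cast le_sup_left) hx)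
  obtain ⟨y, hyL, z, hzN, rfl⟩ := Submodule.mem_sup.1 hy
  refine ⟨y, hyL, ?_⟩
  have proj_eq : (Submodule.span ℝ (L : Set (E n))).starProjection (x - (y + z)) = x - y := by
    rw [map_sub, map_add, Submodule.starProjection_eq_self_iff.2 hx,
      Submodule.starProjection_eq_self_iff.2 (Submodule.subset_span hyL),
      (Submodule.starProjection_apply_eq_zero_iff _).2 (hN hzN), add_zero]
  rw [← proj_eq]
  exact (Submodule.norm_starProjection_apply_le _ _).trans hxy

theorem mem_dual_of_mem_dual_sup {y : E n} (hy : y ∈ dual (L ⊔ N))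
    (hyL : y ∈ Submodule.span ℝ (L : Set (E n))) : y ∈ dual L :=
  ⟨hyL, fun x hx => hy.2 x (Submodule.mem_sup_left hx)⟩

end FullRank

section ScalarExtension

variable [FiniteDimensional ℝ F] {V : Submodule ℝ F} {σ : ℝ} {A : F →ₗ[ℝ] F}

/-- The linear map that agrees with `A` on `V` and with multiplication by `σ` on `Vᗮ`; it extends a
rescaling of the span of a lattice to the whole space. -/
def scalarExtension (V : Submodule ℝ F) (σ : ℝ) (A : F →ₗ[ℝ] F) : F →ₗ[ℝ] F :=
  A ∘ₗ (V.starProjection : F →ₗ[ℝ] F) + σ • (Vᗮ.starProjection : F →ₗ[ℝ] F)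

theorem scalarExtension_apply (V : Submodule ℝ F) (σ : ℝ) (A : F →ₗ[ℝ] F) (x : F) :
    scalarExtension V σ A x = A (V.starProjection x) + σ • Vᗮ.starProjection x := rfl

theorem scalarExtension_of_mem {x : F} (hx : x ∈ V) : scalarExtension V σ A x = A x := by
  rw [scalarExtension_apply, Submodule.starProjection_eq_self_iff.2 hx, ← orthProj_apply,
    orthProj_eq_zero_iff.2 hx, smul_zero, add_zero]

theorem scalarExtension_of_mem_orthogonal {x : F} (hx : x ∈ Vᗮ) :
    scalarExtension V σ A x = σ • x := by
  rw [scalarExtension_apply, (Submodule.starProjection_apply_eq_zero_iff V).2 hx, map_zero,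
    zero_add, Submodule.starProjection_eq_self_iff.2 hx]

theorem orthProj_scalarExtension (hAV : ∀ x ∈ V, A x ∈ V) (x : F) :
    orthProj V (scalarExtension V σ A x) = σ • orthProj V x := by
  rw [scalarExtension_apply, map_add, orthProj_eq_zero_iff.2 (hAV _ (V.starProjection_apply_mem x)),
    zero_add, orthProj_eq_self_iff.2 (Vᗮ.smul_mem σ (Vᗮ.starProjection_apply_mem x)),
    orthProj_apply]

theorem mem_of_scalarExtension_mem (hAV : ∀ x ∈ V, A x ∈ V) (hσ : σ ≠ 0) {x : F}
    (hx : scalarExtension V σ A x ∈ V) : x ∈ V := by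
  rw [← orthProj_eq_zero_iff, orthProj_scalarExtension hAV, smul_eq_zero] at hx
  exact orthProj_eq_zero_iff.1 (hx.resolve_left hσ)

theorem scalarExtension_injective (hAV : ∀ x ∈ V, A x ∈ V) (hA : ∀ x ∈ V, A x = 0 → x = 0)
    (hσ : σ ≠ 0) : Function.Injective (scalarExtension V σ A) := by
  refine (injective_iff_map_eq_zero _).2 fun x hx => ?_
  have hxV : x ∈ V := mem_of_scalarExtension_mem hAV hσ (hx ▸ V.zero_mem)
  exact hA x hxV (by rwa [scalarExtension_of_mem hxV] at hx)

theorem SlopeGE.map_scalarExtension {M : Submodule ℤ F} {κ : Type*} [Fintype κ] {f : κ → F}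
    (hAV : ∀ x ∈ V, A x ∈ V) (hσ : 0 < σ)
    (h : SlopeGE 1 ((M ⊓ V.restrictScalars ℤ).map (A.restrictScalars ℤ)))
    (hf : Submodule.span ℝ (Set.range f) = Vᗮ) (hfσ : ∑ k, ‖f k‖ ^ 2 ≤ σ ^ 2)
    (h_int : ∀ x ∈ M, ∀ k, ∃ z : ℤ, inner ℝ (f k) x = z) :
    SlopeGE 1 (M.map ((scalarExtension V σ A).restrictScalars ℤ)) := by
  refine SlopeGE.of_inf_of_map zero_le_one V (h.mono ?_) ?_
  · rintro _ ⟨⟨x, hx, rfl⟩, hxV⟩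
    have hxV : x ∈ V := mem_of_scalarExtension_mem hAV hσ.ne' hxV
    exact ⟨x, ⟨hx, hxV⟩, (scalarExtension_of_mem hxV).symm⟩
  · have map_eq : ∀ x, orthProj V (((scalarExtension V σ A).restrictScalars ℤ) x) =
        σ • orthProj V x := orthProj_scalarExtension hAV
    rw [← inv_one]
    refine slopeGE_inv_of_inner_int (fun k => σ⁻¹ • f k) ?_ ?_ one_pos ?_
    · rintro _ ⟨y, -, rfl⟩ hy
      refine eq_zero_of_mem_span_of_inner_eq_zero
        (hf.ge (Vᗮ.starProjection_apply_mem y)) fun k => ?_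
      simpa [real_inner_smul_left, hσ.ne'] using hy k
    · rintro _ ⟨_, ⟨x, hx, rfl⟩, rfl⟩ k
      obtain ⟨z, hz⟩ := h_int x hx k
      have hfV : f k ∈ Vᗮ := hf ▸ Submodule.subset_span (Set.mem_range_self k)
      refine ⟨z, ?_⟩
      rw [map_eq, real_inner_smul_left, real_inner_smul_right, inv_mul_cancel_left₀ hσ.ne', ← hz,
        orthProj_apply, ← Submodule.inner_starProjection_left_eq_right,
        Submodule.starProjection_eq_self_iff.2 hfV]
    · simp_rw [norm_smul, mul_pow, ← Finset.mul_sum, norm_inv, inv_pow, Real.norm_eq_abs, sq_abs]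
      rwa [inv_mul_le_iff₀ (by positivity), mul_one]

end ScalarExtension

section LogarithmicBound

variable {n d : ℕ} {L : Submodule ℤ (E n)}

theorem span_range_smul {K V ι : Type*} [DivisionRing K] [AddCommGroup V] [Module K V] (f : ι → V)
    {r : K} (hr : r ≠ 0) :
    Submodule.span K (Set.range fun i => r • f i) = Submodule.span K (Set.range f) := by
  rw [← Submodule.span_smul_eq_of_isUnit (Set.range f) r hr.isUnit, Set.smul_set_range]

theorem sum_norm_sq_scalarExtension_append [FiniteDimensional ℝ F] {V : Submodule ℝ F} {k : ℕ}
    {e : Fin d → F} (he : ∀ i, e i ∈ V) {f : Fin k → F} (hf : Orthonormal ℝ f)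
    (hfV : ∀ j, f j ∈ Vᗮ) (σ : ℝ) (A : F →ₗ[ℝ] F) :
    ∑ i, ‖scalarExtension V σ A (Fin.append e f i)‖ ^ 2 = ∑ i, ‖A (e i)‖ ^ 2 + k * σ ^ 2 := by
  have norm_f : ∀ j, ‖f j‖ = 1 := hf.1
  simp [Fin.sum_univ_add, scalarExtension_of_mem (he _), scalarExtension_of_mem_orthogonal (hfV _),
    norm_smul, norm_f]

theorem IsLattice.isLatticeOfDim_sup_span_range (hL : IsLattice L) {k : ℕ} {f : Fin k → E n}
    (hf : LinearIndependent ℝ f)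
    (span_f : Submodule.span ℝ (Set.range f) = (Submodule.span ℝ (L : Set (E n)))ᗮ) :
    IsLatticeOfDim n (L ⊔ Submodule.span ℤ (Set.range f)) := by
  have sup := hL.isLatticeOfDim.sup ⟨f, hf, rfl⟩ (by
    rw [Submodule.span_span_of_tower, span_f]
    exact Submodule.orthogonal_disjoint _)
  have finrank_add : Module.finrank ℝ (Submodule.span ℝ (L : Set (E n))) + k = n := by
    rw [← Fintype.card_fin k, ← finrank_span_eq_card hf, span_f,
      Submodule.finrank_add_finrank_orthogonal, finrank_euclideanSpace_fin]
  rwa [finrank_add] at sup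

theorem IsLattice.coveringRadius_le_of_scalarExtension (hn : n ≠ 0) (hL : IsLattice L)
    {A : E n →ₗ[ℝ] E n} (hA : ∀ x ∈ Submodule.span ℝ (L : Set (E n)),
      A x ∈ Submodule.span ℝ (L : Set (E n)) ∧ (A x = 0 → x = 0))
    (h : SlopeGE 1 ((EuclLattice.dual L).map (A.restrictScalars ℤ))) {k : ℕ} {f : Fin k → E n}
    (hf : LinearIndependent ℝ f)
    (span_f : Submodule.span ℝ (Set.range f) = (Submodule.span ℝ (L : Set (E n)))ᗮ)
    {σ : ℝ} (hσ : 0 < σ) (hfσ : ∑ j, ‖f j‖ ^ 2 ≤ σ ^ 2) {ι : Type*} [Fintype ι]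
    (g : OrthonormalBasis ι ℝ (E n)) :
    coveringRadius L ≤ detConst n * ENNReal.ofReal
      √(∑ i, ‖scalarExtension (Submodule.span ℝ (L : Set (E n))) σ A (g i)‖ ^ 2) := by
  have slope := SlopeGE.map_scalarExtension
    (M := EuclLattice.dual (L ⊔ Submodule.span ℤ (Set.range f))) (fun x hx => (hA x hx).1) hσ
    (h.mono (Submodule.map_mono fun y hy => mem_dual_of_mem_dual_sup hy.1 hy.2)) span_f hfσ
    fun y hy j => by
      rw [real_inner_comm]
      exact hy.2 _ (Submodule.mem_sup_right (Submodule.subset_span (Set.mem_range_self j)))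
  have span_le : Submodule.span ℤ (Set.range f) ≤
      (Submodule.span ℝ (L : Set (E n)))ᗮ.restrictScalars ℤ :=
    Submodule.span_le.2 fun x hx => span_f.le (Submodule.subset_span hx)
  exact (coveringRadius_le_coveringRadius_sup span_le).trans <|
    (hL.isLatticeOfDim_sup_span_range hf span_f).coveringRadius_le_of_slopeGE_map_dual hn
      (scalarExtension_injective (fun x hx => (hA x hx).1) (fun x hx => (hA x hx).2) hσ.ne') slope g

/-- The lattice is enlarged to full rank by a fine rectangular lattice in the orthogonal complement
of its span, whose rescaling contributes at most `n * σ ^ 2` to the trace. -/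
theorem IsLattice.coveringRadius_le_of_slopeGE_map_dual (hn : n ≠ 0) (hL : IsLattice L)
    {A : E n →ₗ[ℝ] E n} (hA : ∀ x ∈ Submodule.span ℝ (L : Set (E n)),
      A x ∈ Submodule.span ℝ (L : Set (E n)) ∧ (A x = 0 → x = 0))
    (h : SlopeGE 1 ((EuclLattice.dual L).map (A.restrictScalars ℤ))) {e : Fin d → E n}
    (he : Orthonormal ℝ e)
    (span_e : Submodule.span ℝ (Set.range e) = Submodule.span ℝ (L : Set (E n)))
    {σ : ℝ} (hσ : 0 < σ) :
    coveringRadius L ≤ detConst n * ENNReal.ofReal √(∑ j, ‖A (e j)‖ ^ 2 + n * σ ^ 2) := by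
  set V := Submodule.span ℝ (L : Set (E n)) with hV
  let f := stdOrthonormalBasis ℝ Vᗮ
  have hf : Orthonormal ℝ fun j => (f j : E n) := f.orthonormal.comp_linearIsometry Vᗮ.subtypeₗᵢ
  have norm_f : ∀ j, ‖(f j : E n)‖ = 1 := hf.1
  have span_f : Submodule.span ℝ (Set.range fun j => (f j : E n)) = Vᗮ := by
    simpa using span_range_coe_basis f.toBasis
  have heV : ∀ j, e j ∈ V := fun j => span_e.le (Submodule.subset_span (Set.mem_range_self j))
  let g : OrthonormalBasis _ ℝ (E n) := .mk
    (orthonormal_append he hf fun i j => Submodule.inner_right_of_mem_orthogonal (heV i) (f j).2)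
    (by rw [span_range_append, span_e, span_f, Submodule.sup_orthogonal_of_hasOrthogonalProjection])
  have finrank_le : (Module.finrank ℝ Vᗮ : ℝ) ≤ n := by
    exact_mod_cast Vᗮ.finrank_le.trans_eq finrank_euclideanSpace_fin
  have hn0 : (0 : ℝ) < n := by exact_mod_cast Nat.pos_of_ne_zero hn
  have hr : σ / √n ≠ 0 := by positivity
  refine (hL.coveringRadius_le_of_scalarExtension hn hA h (f := fun j => (σ / √n) • (f j : E n))
    (hf.linearIndependent.units_smul fun _ => Units.mk0 _ hr)
    ((span_range_smul _ hr).trans span_f) hσ ?_ g).trans ?_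
  · simpa [norm_smul, norm_f, div_pow, mul_div_left_comm] using
      mul_le_of_le_one_right (sq_nonneg σ) ((div_le_one hn0).2 finrank_le)
  · simp only [g, OrthonormalBasis.coe_mk, ← hV,
      sum_norm_sq_scalarExtension_append heV hf (fun j => (f j).2)]
    gcongr

theorem IsSlopeScaling.inv_le_div {e : Fin d → E n} {t : Fin d → ℝ} {θ : ℝ}
    {A : E n →ₗ[ℝ] E n} (h : IsSlopeScaling θ (dual L) e t A) (hL : IsLattice L) (hθ : 0 < θ)
    {κ : ℝ} (hκ : 0 < κ) (hLκ : klBound L ≤ ENNReal.ofReal κ) (j : Fin d) :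
    (t j)⁻¹ ≤ θ * κ ^ 2 * ((j : ℝ) + 1)⁻¹ := by
  have htj := h.pos j
  obtain ⟨k, c, hjk, hc, hci, hct⟩ := h.exists_gramDet_le j
  have pow_le := ((klBound_le_ofReal_iff hL hκ).1 hLκ k c hc hci).trans hct
  have div_le : k / κ ^ 2 ≤ θ * t j :=
    (pow_le_pow_iff_left₀ (by positivity) (by positivity) (by omega)).1 pow_le
  have succ_le : (j : ℝ) + 1 ≤ k := by exact_mod_cast hjk
  rw [div_le_iff₀ (by positivity)] at div_le
  rw [← div_eq_mul_inv, le_div_iff₀ (by positivity), inv_mul_le_iff₀ htj]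
  linarith

theorem sum_inv_succ_le_one_add_log (d : ℕ) :
    ∑ j : Fin d, ((j : ℝ) + 1)⁻¹ ≤ 1 + Real.log d := by
  have harmonic_le := harmonic_le_one_add_log d
  rw [harmonic] at harmonic_le
  push_cast at harmonic_le
  rwa [Fin.sum_univ_eq_sum_range (fun j : ℕ => ((j : ℝ) + 1)⁻¹) d]

theorem IsSlopeScaling.sum_inv_le_log {e : Fin d → E n} {t : Fin d → ℝ} {θ : ℝ}
    {A : E n →ₗ[ℝ] E n} (h : IsSlopeScaling θ (dual L) e t A) (hL : IsLattice L) (hθ : 0 < θ)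
    {κ : ℝ} (hκ : 0 < κ) (hLκ : klBound L ≤ ENNReal.ofReal κ) :
    ∑ j, (t j)⁻¹ ≤ θ * κ ^ 2 * (1 + Real.log d) := calc
  ∑ j, (t j)⁻¹ ≤ ∑ j : Fin d, θ * κ ^ 2 * ((j : ℝ) + 1)⁻¹ :=
    Finset.sum_le_sum fun j _ => h.inv_le_div hL hθ hκ hLκ j
  _ = θ * κ ^ 2 * ∑ j : Fin d, ((j : ℝ) + 1)⁻¹ := by rw [Finset.mul_sum]
  _ ≤ θ * κ ^ 2 * (1 + Real.log d) := by
    gcongr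
    exact sum_inv_succ_le_one_add_log d

theorem IsLatticeOfDim.coveringRadius_le_log_mul (hd : d ≠ 0) (hL : IsLatticeOfDim d L) {κ : ℝ}
    (hκ : 0 < κ) (hLκ : klBound L ≤ ENNReal.ofReal κ) :
    coveringRadius L ≤ detConst n * ENNReal.ofReal (2 * (1 + Real.log n) * κ) := by
  have hL' : IsLattice L := ⟨d, hL⟩
  obtain ⟨c₀, hc₀, slope⟩ := hL'.dual.exists_slopeGE
  obtain ⟨e, t, A, h⟩ := exists_isSlopeScaling hc₀ slope one_lt_two hL.dual.finrank_span
  have hA := fun x hx => h.map_mem_span_and_eq_zero (x := x) hx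
  have span_e := h.span_eq
  rw [hL'.span_dual] at hA span_e
  have d_le : d ≤ n := by
    simpa [hL.finrank_span] using (Submodule.span ℝ (L : Set (E n))).finrank_le
  have hn0 : (0 : ℝ) < n := by exact_mod_cast (Nat.pos_of_ne_zero hd).trans_le d_le
  have log_nonneg : 0 ≤ Real.log n := Real.log_natCast_nonneg n
  refine (hL'.coveringRadius_le_of_slopeGE_map_dual (by omega) hA h.slopeGE_map h.orthonormal
    span_e (σ := κ / √n) (by positivity)).trans ?_
  gcongr
  refine Real.sqrt_le_iff.2 ⟨by positivity, ?_⟩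
  simp only [h.norm_map_sq, div_pow, Real.sq_sqrt hn0.le, mul_div_cancel₀ _ hn0.ne']
  calc ∑ j, (t j)⁻¹ + κ ^ 2 ≤ 2 * κ ^ 2 * (1 + Real.log d) + κ ^ 2 := by
        gcongr
        exact h.sum_inv_le_log hL' two_pos hκ hLκ
    _ ≤ 2 * κ ^ 2 * (1 + Real.log n) + κ ^ 2 := by gcongr
    _ ≤ (2 * (1 + Real.log n) * κ) ^ 2 := by
      nlinarith [mul_nonneg (sq_nonneg κ) log_nonneg, sq_nonneg (κ * Real.log n)]

theorem klConst_le_log_mul_detConst (n : ℕ) :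
    klConst n ≤ ENNReal.ofReal (2 * (1 + Real.log n)) * detConst n := by
  refine sInf_le ?_
  rintro L ⟨d, hL⟩
  rcases eq_or_ne d 0 with rfl | hd
  · exact hL.coveringRadius_eq_zero.trans_le zero_le
  obtain ⟨κ, hκ, κ_eq⟩ := exists_pos_ofReal_eq (hL.klBound_ne_zero hd)
    (IsLattice.klBound_ne_top ⟨d, hL⟩)
  have := Real.log_natCast_nonneg n
  calc coveringRadius L ≤ detConst n * ENNReal.ofReal (2 * (1 + Real.log n) * κ) :=
        hL.coveringRadius_le_log_mul hd hκ κ_eq.ge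
    _ = ENNReal.ofReal (2 * (1 + Real.log n)) * detConst n * klBound L := by
        rw [ENNReal.ofReal_mul (by positivity), κ_eq]
        ring

end LogarithmicBound

section Positivity

variable {n : ℕ}

theorem isLatticeOfDim_span_singleton {v : E n} (hv : v ≠ 0) :
    IsLatticeOfDim 1 (Submodule.span ℤ {v}) :=
  ⟨fun _ => v, .of_subsingleton 0 hv, by rw [Set.range_const]⟩

theorem half_le_abs_half_sub_intCast (z : ℤ) : (1 / 2 : ℝ) ≤ |1 / 2 - (z : ℝ)| := by
  rcases le_or_gt z 0 with hz | hz
  · have : (z : ℝ) ≤ 0 := by exact_mod_cast hz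
    exact le_abs.2 (.inl (by linarith))
  · have : (1 : ℝ) ≤ z := by exact_mod_cast hz
    exact le_abs.2 (.inr (by linarith))

theorem half_norm_le_coveringRadius_span_singleton (v : E n) :
    ENNReal.ofReal (1 / 2 * ‖v‖) ≤ coveringRadius (Submodule.span ℤ {v}) := by
  refine le_iInf₂ fun r hr => ?_
  obtain ⟨_, hy, hvr⟩ := hr ((1 / 2 : ℝ) • v)
    (Submodule.smul_mem _ _ (Submodule.subset_span (Submodule.mem_span_singleton_self v)))
  obtain ⟨z, rfl⟩ := Submodule.mem_span_singleton.1 hy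
  rw [← Int.cast_smul_eq_zsmul ℝ, ← sub_smul, norm_smul, Real.norm_eq_abs] at hvr
  rw [← ENNReal.ofReal_coe_nnreal]
  gcongr
  exact (mul_le_mul_of_nonneg_right (half_le_abs_half_sub_intCast z) (norm_nonneg v)).trans hvr

theorem klConst_pos (hn : n ≠ 0) : 0 < klConst n := by
  have : NeZero n := ⟨hn⟩
  obtain ⟨v, hv⟩ := exists_ne (0 : E n)
  refine pos_iff_ne_zero.2 fun klConst_eq => ?_
  have le_zero := (half_norm_le_coveringRadius_span_singleton v).trans
    ((isLeast_klConst n).1 _ ⟨1, isLatticeOfDim_span_singleton hv⟩)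
  rw [klConst_eq, zero_mul, nonpos_iff_eq_zero, ENNReal.ofReal_eq_zero] at le_zero
  linarith [norm_pos_iff.2 hv]

theorem detConst_pos (hn : n ≠ 0) : 0 < detConst n := by
  have mul_pos := (klConst_pos hn).trans_le (klConst_le_log_mul_detConst n)
  exact pos_iff_ne_zero.2 (right_ne_zero_of_mul mul_pos.ne')

end Positivity

section Polylog

variable {f g : ℕ → ℝ≥0∞}

theorem PolylogBounded.of_le (h : ∀ n, f n ≤ g n) (hg : PolylogBounded g) : PolylogBounded f := by
  obtain ⟨A, k, hA⟩ := hg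
  exact ⟨A, k, fun n hn => (h n).trans (hA n hn)⟩

theorem one_add_log_le_three_mul_log {x : ℝ} (hx : 2 ≤ x) : 1 + Real.log x ≤ 3 * Real.log x := by
  linarith [Real.log_le_log two_pos hx, Real.log_two_gt_d9]

theorem PolylogBounded.of_le_log_mul {K : ℝ} (hK : 0 ≤ K)
    (h : ∀ n : ℕ, f n ≤ ENNReal.ofReal (K * (1 + Real.log n)) * g n) (hg : PolylogBounded g) :
    PolylogBounded f := by
  obtain ⟨A, k, hA⟩ := hg
  refine ⟨K * 3 * |A|, k + 1, fun n hn => ?_⟩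
  have : 0 ≤ Real.log n := Real.log_natCast_nonneg n
  have log_le := one_add_log_le_three_mul_log (x := n) (by exact_mod_cast hn)
  calc f n ≤ ENNReal.ofReal (K * (1 + Real.log n)) * g n := h n
    _ ≤ ENNReal.ofReal (K * (3 * Real.log n)) * ENNReal.ofReal (|A| * Real.log n ^ k) := by
      gcongr
      exact (hA n hn).trans (by gcongr; exact le_abs_self A)
    _ = ENNReal.ofReal (K * 3 * |A| * Real.log n ^ (k + 1)) := by
      rw [← ENNReal.ofReal_mul (by positivity)]
      ring_nf

end Polylog

end EuclLattice

end

theorem mainTheorem2 :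
    (∀ n : ℕ, 1 ≤ n →
      IsLeast {C : ENNReal | ∀ L : Submodule ℤ (EuclLattice.E n),
        EuclLattice.IsLatticeOfDim n L →
          EuclLattice.etaMuCirc L ≤ C * EuclLattice.etaDet L} (EuclLattice.detConst n) ∧
      IsLeast {C : ENNReal | ∀ L : Submodule ℤ (EuclLattice.E n),
        EuclLattice.IsLattice L →
          EuclLattice.coveringRadius L ≤ C * EuclLattice.klBound L} (EuclLattice.klConst n) ∧
      0 < EuclLattice.detConst n ∧
      EuclLattice.detConst n ≤ EuclLattice.klConst n ∧
      EuclLattice.klConst n < ⊤) ∧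
    (∃ K : ℝ, 0 < K ∧ ∀ n : ℕ, 1 ≤ n →
      EuclLattice.klConst n ≤
        ENNReal.ofReal (K * (1 + Real.log n)) * EuclLattice.detConst n) ∧
    (EuclLattice.KLConjecture ↔ EuclLattice.PolylogBounded EuclLattice.detConst) := by
  open EuclLattice in
  exact ⟨fun n hn => ⟨isLeast_detConst (by omega), isLeast_klConst n, detConst_pos (by omega),
      detConst_le_klConst n, (klConst_le n).trans_lt (ENNReal.natCast_lt_top n)⟩,
    ⟨2, two_pos, fun n _ => klConst_le_log_mul_detConst n⟩,
    fun h => PolylogBounded.of_le detConst_le_klConst h,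
    fun h => PolylogBounded.of_le_log_mul zero_le_two klConst_le_log_mul_detConst h⟩
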